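/- Let $n\ge 1$ and $0\le k\le n$ be integers. Multiply permutations from right to left. For $w\in S_n$ let $\ell(w)$ be its number of inversions and $\sigma_k(w)=w(\{1,\dots,k\})$. Let $\le$ be the Bruhat order on $S_n$, and let $[u,w]=\{v\in S_n : u\le v\le w\}$. The $k$-Bruhat order $\le_k$ on $S_n$ is the reflexive and transitive closure of the relations $u\lessdot_k w$, where $u\lessdot_k w$ means that $w$ covers $u$ in Bruhat order and $\sigma_k(u)\ne\sigma_k(w)$. Let $[u,w]_k$ denote the interval of $\le_k$ with ends $u\le_k w$. Let $\mathcal Q(k,n)$ be the set of classes $\langle u,w\rangle$ of $k$-Bruhat intervals $[u,w]_k$ under the equivalence relation generated by $[u,w]_k\sim[uz,wz]_k$, where $z\in S_k\times S_{n-k}$ satisfies $\ell(uz)=\ell(u)+\ell(z)$ and $\ell(wz)=\ell(w)+\ell(z)$. For $q,q'\in\mathcal Q(k,n)$ put $q'\le q$ if and only if there are representatives $[u,w]_k\in q$ and $[u',w']_k\in q'$ with $[u,w]\subseteq[u',w']$ (larger intervals are lower). Let $\tilde S_n$ be the group of bijections $f:\mathbb Z\to\mathbb Z$ with $f(i+n)=f(i)+n$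 for all $i$. It contains $S_n$ (by periodic extension) and the translations $t_\mu$, $\mu\in\mathbb Z^n$, determined by $t_\mu(i)=i+n\mu_i$ for $1\le i\le n$. Let $\tilde S_n^k=\{f\in\tilde S_n : \frac1n\sum_{i=1}^n(f(i)-i)=k\}$. The length $\ell(f)$ of $f\in\tilde S_n$ is the number of inversions of $f$, i.e. pairs $i<j$ of integers with $f(i)>f(j)$, counted modulo simultaneous translation of $i$ and $j$ by multiples of $n$. The set $\tilde S_n^k$ carries the partial order transported from the Bruhat order of the Coxeter group $\tilde S_n^0$ by the bijection $\tilde S_n^0\to\tilde S_n^k$, $f\mapsto f\circ(i\mapsto i+k)$. Let $\mathrm{Bound}(k,n)=\{f\in\tilde S_n^k : i\le f(i)\le i+n\text{ for all }i\in\mathbb Z\}$ with the restricted order. Let $\omega_k=(1,\dots,1,0,\dots,0)\in\mathbb Z^n$ with $k$ ones, and for $u\le_k w$ put $f_{u,w}=u\,t_{\omega_k}w^{-1}\in\tilde S_n$. Theorem. The relation $\le$ on $\mathcal Q(k,n)$ is a partial order, and $\langle u,w\rangle\mapsto f_{u,w}$ is a well-defined map $\mathcal Q(k,n)\to\mathrm{Bound}(k,n)$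 that is an isomorphism of posets. Moreover, for all $u\le_k w$, $$\ell(f_{u,w})=k(n-k)-\ell(w)+\ell(u).$$ -/

import Mathlib

namespace Positroid

/-! ### The finite symmetric group

The set `[n] = {1, …, n}` is modelled by `Fin n`: the element `a : Fin n` stands for `a + 1`. -/

section Finite

variable {n : ℕ}

/-- The length of a permutation: its number of inversions. -/
def permLength (w : Equiv.Perm (Fin n)) : ℕ :=
  (Finset.univ.filter fun p : Fin n × Fin n => p.1 < p.2 ∧ w p.2 < w p.1).card

/-- An elementary step up in Bruhat order: multiplication by a transposition (that is, by a
reflection of the Coxeter group `S_n`) that increases the length. -/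
def BruhatStep (u w : Equiv.Perm (Fin n)) : Prop :=
  ∃ a b : Fin n, a ≠ b ∧ w = u * Equiv.swap a b ∧ permLength u < permLength w

/-- The Bruhat (strong) order on `S_n`. -/
def BruhatLE : Equiv.Perm (Fin n) → Equiv.Perm (Fin n) → Prop :=
  Relation.ReflTransGen BruhatStep

/-- The strict Bruhat order on `S_n`. -/
def BruhatLT (u w : Equiv.Perm (Fin n)) : Prop := BruhatLE u w ∧ u ≠ w

/-- `u ⋖ w` in Bruhat order. -/
def BruhatCover (u w : Equiv.Perm (Fin n)) : Prop :=
  BruhatLT u w ∧ ∀ v, ¬ (BruhatLT u v ∧ BruhatLT v w)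

/-- The interval `[u, w]` in Bruhat order. -/
def bruhatInterval (u w : Equiv.Perm (Fin n)) : Set (Equiv.Perm (Fin n)) :=
  {v | BruhatLE u v ∧ BruhatLE v w}

/-- `σ_k(w) = w([k])`. -/
def sigma (k : ℕ) (w : Equiv.Perm (Fin n)) : Finset (Fin n) :=
  (Finset.univ.filter fun a : Fin n => (a : ℕ) < k).image w

/-- `u ⋖_k w`: a Bruhat cover that changes the image of `[k]`. -/
def KBruhatCover (k : ℕ) (u w : Equiv.Perm (Fin n)) : Prop :=
  BruhatCover u w ∧ sigma k u ≠ sigma k w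

/-- The `k`-Bruhat order `u ≤_k w` on `S_n`. -/
def KBruhatLE (k : ℕ) : Equiv.Perm (Fin n) → Equiv.Perm (Fin n) → Prop :=
  Relation.ReflTransGen (KBruhatCover k)

/-- `z` lies in the parabolic subgroup `S_k × S_{n-k}`. -/
def InParabolic (k : ℕ) (z : Equiv.Perm (Fin n)) : Prop :=
  ∀ a : Fin n, ((z a : Fin n) : ℕ) < k ↔ (a : ℕ) < k

end Finite

/-- A `k`-Bruhat interval `[u, w]_k` of `S_n`, given by its end points `u ≤_k w`. -/
structure KBruhatInterval (k n : ℕ) where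
  /-- the lower end -/
  u : Equiv.Perm (Fin n)
  /-- the upper end -/
  w : Equiv.Perm (Fin n)
  /-- the ends are comparable -/
  le : KBruhatLE k u w

/-- `[u,w]_k` and `[x,y]_k` are related if `x = u z` and `y = w z` are both length-additive
factorizations for one `z ∈ S_k × S_{n-k}`. -/
def KBruhatInterval.Rel {k n : ℕ} (I J : KBruhatInterval k n) : Prop :=
  ∃ z : Equiv.Perm (Fin n), InParabolic k z ∧
    J.u = I.u * z ∧ permLength J.u = permLength I.u + permLength z ∧
    J.w = I.w * z ∧ permLength J.w = permLength I.w + permLength z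

/-- `Q(k,n)`: the classes of `k`-Bruhat intervals under the equivalence relation generated by
`KBruhatInterval.Rel`. -/
def Q (k n : ℕ) : Type :=
  Quotient (Relation.EqvGen.setoid (KBruhatInterval.Rel (k := k) (n := n)))

/-- The class `⟨u,w⟩` of `[u,w]_k`. -/
def Q.mk {k n : ℕ} (I : KBruhatInterval k n) : Q k n :=
  Quotient.mk (Relation.EqvGen.setoid (KBruhatInterval.Rel (k := k) (n := n))) I

/-- `q' ≤ q` if there are representatives `[u,w]_k` of `q` and `[u',w']_k` of `q'` whose Bruhat
intervals satisfy `[u,w] ⊆ [u',w']`: larger intervals are lower. -/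
instance {k n : ℕ} : LE (Q k n) where
  le q' q := ∃ I' I : KBruhatInterval k n, Q.mk I' = q' ∧ Q.mk I = q ∧
    bruhatInterval I.u I.w ⊆ bruhatInterval I'.u I'.w

/-! ### Affine permutations -/

/-- The group `S̃_n` of affine permutations: bijections `f : ℤ → ℤ` with `f (i + n) = f i + n`. -/
def AffinePerm (n : ℕ) : Subgroup (Equiv.Perm ℤ) where
  carrier := {f | ∀ i : ℤ, f (i + n) = f i + n}
  mul_mem' := by
    intro f g hf hg i
    simp only [Set.mem_ofPred_eq] at hf hg
    simp [Equiv.Perm.mul_apply, hg, hf]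
  one_mem' := by intro i; simp
  inv_mem' := by
    intro f hf i
    simp only [Set.mem_ofPred_eq] at hf
    rw [Equiv.Perm.inv_eq_iff_eq, hf]
    simp

section Affine

variable {n : ℕ}

/-- The ball number `(1/n) ∑_{i=1}^n (f(i) - i)`. -/
noncomputable def ballNumber (f : AffinePerm n) : ℚ :=
  (1 / (n : ℚ)) * ∑ i ∈ Finset.Icc (1 : ℤ) n, (((f : Equiv.Perm ℤ) i : ℚ) - (i : ℚ))

/-- The inversions of `f`: pairs `i < j` of integers with `f i > f j`. -/
def AffineInversion (f : AffinePerm n) : Type :=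
  {p : ℤ × ℤ // p.1 < p.2 ∧ (f : Equiv.Perm ℤ) p.2 < (f : Equiv.Perm ℤ) p.1}

/-- Two inversions are equivalent if they differ by a simultaneous shift by a multiple of `n`. -/
def affineInversionSetoid (f : AffinePerm n) : Setoid (AffineInversion f) where
  r p q := ∃ r : ℤ, q.1.1 = p.1.1 + r * n ∧ q.1.2 = p.1.2 + r * n
  iseqv := by
    refine ⟨fun p => ⟨0, by simp⟩, ?_, ?_⟩
    · rintro p q ⟨r, h1, h2⟩
      exact ⟨-r, by rw [h1]; ring, by rw [h2]; ring⟩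
    · rintro p q s ⟨r, h1, h2⟩ ⟨r', h3, h4⟩
      exact ⟨r + r', by rw [h3, h1]; ring, by rw [h4, h2]; ring⟩

/-- The length of an affine permutation: its number of equivalence classes of inversions. -/
noncomputable def affineLength (f : AffinePerm n) : ℕ :=
  Nat.card (Quotient (affineInversionSetoid f))

/-- `t` is the affine transposition that swaps `i + rn` and `j + rn` for every integer `r`, where
`i` and `j` are not congruent modulo `n`. These are the reflections of the Coxeter group `S̃_n^0`,
the simple ones being those with `j = i + 1`. -/
def IsAffineTransposition (i j : ℤ) (t : AffinePerm n) : Prop :=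
  ¬ (i ≡ j [ZMOD n]) ∧
    (∀ r : ℤ, (t : Equiv.Perm ℤ) (i + r * n) = j + r * n) ∧
    (∀ r : ℤ, (t : Equiv.Perm ℤ) (j + r * n) = i + r * n) ∧
    (∀ m : ℤ, ¬ (m ≡ i [ZMOD n]) → ¬ (m ≡ j [ZMOD n]) → (t : Equiv.Perm ℤ) m = m)

/-- An elementary step up in affine Bruhat order: multiplication by a reflection that increases
the length. -/
def AffineBruhatStep (f g : AffinePerm n) : Prop :=
  ∃ (i j : ℤ) (t : AffinePerm n), IsAffineTransposition i j t ∧ g = f * t ∧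
    affineLength f < affineLength g

/-- The shift `i ↦ i + 1`. -/
def shift (n : ℕ) : AffinePerm n :=
  ⟨Equiv.addRight (1 : ℤ), fun i => by simp only [Equiv.coe_addRight]; ring⟩

/-- The Bruhat order on the Coxeter group `S̃_n^0`, written for elements of `S̃_n`; a step never
changes the ball number, since it multiplies by an element of ball number `0`. -/
def AffineBruhatLE : AffinePerm n → AffinePerm n → Prop :=
  Relation.ReflTransGen AffineBruhatStep

/-- The Bruhat order on the coset `S̃_n^k` (the elements of ball number `k`), carried over from
`S̃_n^0` by the bijection `f ↦ f ∘ (i ↦ i - k)`. -/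
def AffineBruhatLEOn (k : ℤ) (f g : AffinePerm n) : Prop :=
  AffineBruhatLE (f * shift n ^ (-k)) (g * shift n ^ (-k))

theorem AffineBruhatLE.eq_or_lt {f g : AffinePerm n} (h : AffineBruhatLE f g) :
    f = g ∨ affineLength f < affineLength g := by
  induction h with
  | refl => exact Or.inl rfl
  | tail _ hs ih =>
    obtain ⟨_, _, _, _, _, hl⟩ := hs
    rcases ih with rfl | ih
    · exact Or.inr hl
    · exact Or.inr (ih.trans hl)

end Affine

/-- `Bound(k,n)`: the bounded affine permutations, `f ∈ S̃_n^k` with `i ≤ f i ≤ i + n`. -/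
structure Bound (k n : ℕ) where
  /-- the affine permutation -/
  f : AffinePerm n
  /-- it lies in `S̃_n^k` -/
  ball : ballNumber f = k
  /-- it is bounded -/
  bounded : ∀ i : ℤ, i ≤ (f : Equiv.Perm ℤ) i ∧ (f : Equiv.Perm ℤ) i ≤ i + n

theorem Bound.ext_f {k n : ℕ} {f g : Bound k n} (h : f.f = g.f) : f = g := by
  cases f; cases g; cases h; rfl

/-- The restriction of the Bruhat order of `S̃_n^k` to `Bound(k,n)`. -/
instance {k n : ℕ} : PartialOrder (Bound k n) where
  le f g := AffineBruhatLEOn (k : ℤ) f.f g.f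
  le_refl _ := Relation.ReflTransGen.refl
  le_trans _ _ _ h h' := Relation.ReflTransGen.trans h h'
  le_antisymm f g h h' := by
    apply Bound.ext_f
    rcases AffineBruhatLE.eq_or_lt h with e | l
    · exact mul_right_cancel e
    · rcases AffineBruhatLE.eq_or_lt h' with e' | l'
      · exact (mul_right_cancel e').symm
      · exact absurd (l.trans l') (lt_irrefl _)

/-! ### From pairs of permutations to affine permutations -/

section Pairs

variable {n : ℕ} [NeZero n]

/-- The residue of `i` modulo `n`, taken in `[n] = {1, …, n}` and seen as an element of `Fin n`. -/
def residue (n : ℕ) [NeZero n] (i : ℤ) : Fin n :=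
  ⟨((i - 1) % n).toNat, by
    have hn : (0 : ℤ) < n := by exact_mod_cast NeZero.pos n
    have h1 := Int.emod_nonneg (i - 1) hn.ne'
    have h2 := Int.emod_lt_of_pos (i - 1) hn
    omega⟩

theorem residue_val (i : ℤ) : ((residue n i : ℕ) : ℤ) = (i - 1) % n := by
  have hn : (0 : ℤ) < n := by exact_mod_cast NeZero.pos n
  exact Int.toNat_of_nonneg (Int.emod_nonneg (i - 1) hn.ne')

theorem residue_add_mul (i r : ℤ) : residue n (i + n * r) = residue n i := by
  apply Fin.ext
  have h : ((residue n (i + n * r) : ℕ) : ℤ) = ((residue n i : ℕ) : ℤ) := by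
    rw [residue_val, residue_val, show i + n * r - 1 = i - 1 + n * r by ring,
      Int.add_mul_emod_self_left]
  exact_mod_cast h

theorem residue_coe (a : Fin n) : residue n ((a : ℕ) + 1 : ℤ) = a := by
  apply Fin.ext
  have h : ((residue n ((a : ℕ) + 1 : ℤ) : ℕ) : ℤ) = ((a : ℕ) : ℤ) := by
    rw [residue_val, add_sub_cancel_right]
    exact Int.emod_eq_of_lt (by positivity) (by exact_mod_cast a.2)
  exact_mod_cast h

/-- The periodic extension of `w : [n] → [n]` to `ℤ`. -/
def extendFun (w : Equiv.Perm (Fin n)) (i : ℤ) : ℤ :=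
  ((w (residue n i) : ℕ) : ℤ) + 1 + n * ((i - 1) / n)

theorem extendFun_inv (w : Equiv.Perm (Fin n)) (i : ℤ) : extendFun w⁻¹ (extendFun w i) = i := by
  have hn : (0 : ℤ) < n := by exact_mod_cast NeZero.pos n
  have h1 : residue n (extendFun w i) = w (residue n i) := by
    unfold extendFun
    rw [residue_add_mul, residue_coe]
  have h2 : (extendFun w i - 1) / n = (i - 1) / n := by
    unfold extendFun
    rw [show ((w (residue n i) : ℕ) : ℤ) + 1 + n * ((i - 1) / n) - 1
        = ((w (residue n i) : ℕ) : ℤ) + n * ((i - 1) / n) by ring,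
      Int.add_mul_ediv_left _ _ hn.ne',
      Int.ediv_eq_zero_of_lt (by positivity) (by exact_mod_cast (w (residue n i)).2), zero_add]
  have h3 := Int.emod_add_mul_ediv (i - 1) n
  have h4 : w⁻¹ (w (residue n i)) = residue n i := Equiv.symm_apply_apply w _
  rw [extendFun, h1, h2, h4, residue_val]
  linarith

/-- The splitting `S_n → S̃_n`: periodic extension. -/
def extend (w : Equiv.Perm (Fin n)) : AffinePerm n :=
  ⟨{ toFun := extendFun w
     invFun := extendFun w⁻¹
     left_inv := extendFun_inv w
     right_inv := fun i => by simpa using extendFun_inv w⁻¹ i }, fun i => by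
      have hn : (0 : ℤ) < n := by exact_mod_cast NeZero.pos n
      have h := residue_add_mul (n := n) i 1
      rw [mul_one] at h
      simp only [Equiv.coe_fn_mk, extendFun]
      rw [h, show i + (n : ℤ) - 1 = i - 1 + n * 1 by ring, Int.add_mul_ediv_left _ _ hn.ne']
      ring⟩

/-- The translation element: `t_μ(i) = n μ_i + i` for `1 ≤ i ≤ n`, extended periodically. -/
def translation (μ : Fin n → ℤ) : AffinePerm n :=
  ⟨{ toFun := fun i => n * μ (residue n i) + i
     invFun := fun i => n * (- μ (residue n i)) + i
     left_inv := fun i => by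
       simp only
       rw [add_comm _ i, residue_add_mul]
       ring
     right_inv := fun i => by
       simp only
       rw [add_comm _ i, residue_add_mul]
       ring }, fun i => by
      have h := residue_add_mul (n := n) i 1
      rw [mul_one] at h
      simp only [Equiv.coe_fn_mk]
      rw [h]
      ring⟩

/-- `ω_k = (1, …, 1, 0, …, 0)` with `k` ones. -/
def omega (k : ℕ) (a : Fin n) : ℤ := if (a : ℕ) < k then 1 else 0

/-- `f_{u,w} = u t_{ω_k} w⁻¹`. -/
def pairAffine (k : ℕ) (u w : Equiv.Perm (Fin n)) : AffinePerm n :=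
  extend u * translation (omega k) * (extend w)⁻¹

end Pairs

end Positroid

/-!
Write `f = f_{u,w}`. In window notation `f (w a) = u a + n` for `a ≤ k` and `f (w b) = u b` for
`b > k` (`pairAffine_apply`), so everything about `f` can be read off from the pairs of values
`(u a, w a)`.

*Criterion.* By Bergeron and Sottile, `u ≤_k w` holds if and only if (1) `u a ≤ w a` for `a ≤ k` and
`u b ≥ w b` for `b > k`, and (2) within each of the blocks `{1, …, k}` and `{k + 1, …, n}`, entries
in increasing order in `u` are in increasing order in `w` (`kBruhatLE_iff`). Condition (1) says
exactly that `f` is bounded (`isBounded_pairAffine_iff`). Condition (2) can always be achieved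
without changing `f`, by swapping positions of a block in `u` and `w` together; each such swap moves
`u` up and `w` down in Bruhat order (`MovesUpDown.exists_kBruhatLE`).

*Bijection.* A bounded `f` of ball number `k` has `k` values `f i > n` with `i ∈ [n]`; any `w` that
sends `[k]` to these `i` gives a pair `(u, w)` satisfying (1), which is then corrected to satisfy
(2). Conversely, if `w` has a descent at adjacent positions of one block, so does `u` by (2), and
removing both is one of the generating relations of `Q(k,n)`. Hence every class has a
representative with Grassmannian `w`, and that representative is determined by `f`
(`mk_eq_of_pairAffine_eq`).

*Larger intervals have smaller `f`.* By the lifting property a containment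
`u' ≤ u ≤ w ≤ w'` can be carried along until `w'` is Grassmannian (`exists_grassmannian_of_le`). For
such `w'`, every Bruhat step from `u'` to `u` raises `f_{-,w'}`, and `w ≤ w'` implies `w ≤_k w'`,
where every `k`-Bruhat cover from `w` to `w'` lowers `f_{u,-}`. So
`f_{u',w'} ≤ f_{u,w'} ≤ f_{u,w}` (`affineBruhatLE_of_subset`).

*Smaller `f` come from larger intervals.* Bounded affine permutations form a lower set, so a chain
below a bounded `g` stays bounded. An affine reflection that takes `f_{u,w}` up to a bounded element
is either a transposition raising `u` or one lowering `w` (`SwapUp.exists_pair`), so following the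
chain from `f_{u,w}` to `g` shrinks the Bruhat interval
(`AffineBruhatLE.exists_kBruhatInterval`). Since the map is bijective and both preserves and reflects
order, the relation on `Q(k,n)` inherits the axioms of a partial order.

*Length.* By boundedness, classes of inversions of `f` correspond to certain pairs of positions
`a < b`, and (1) and (2) compare the inversions of `u` and `w` pair by pair
(`KBruhatLE.affineLength_eq_card`, `KBruhatLE.card_lengthPairs`).
-/

namespace Positroid

/-! ### Lengths and covers in the symmetric group -/

section Finite
variable {n : ℕ}

/-- Lengths of `u` and `u * swap a b` are compared through this map on pairs: apply the
transposition to both entries if that keeps them in order, and do nothing otherwise. -/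
def swapPair (a b : Fin n) (p : Fin n × Fin n) : Fin n × Fin n :=
  if Equiv.swap a b p.1 < Equiv.swap a b p.2 then (Equiv.swap a b p.1, Equiv.swap a b p.2) else p

theorem swap_trichotomy (a b x : Fin n) :
    (x = a ∧ Equiv.swap a b x = b) ∨ (x = b ∧ Equiv.swap a b x = a) ∨
      (x ≠ a ∧ x ≠ b ∧ Equiv.swap a b x = x) := by
  by_cases h : x = a
  · subst h; simp
  by_cases h' : x = b
  · subst h'; simp
  · exact Or.inr (Or.inr ⟨h, h', Equiv.swap_apply_of_ne_of_ne h h'⟩)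

theorem swapPair_injOn (a b : Fin n) : Set.InjOn (swapPair a b) {p | p.1 < p.2} := by
  rintro ⟨x, y⟩ hp ⟨x', y'⟩ hq h
  have h1 := Equiv.swap_apply_self a b
  have hi := (Equiv.swap a b).injective
  simp only [Set.mem_ofPred_eq] at hp hq
  unfold swapPair at h
  simp only at h
  split_ifs at h with c1 c2 c2
  · rw [Prod.mk.injEq] at h
    rw [hi h.1, hi h.2]
  · rw [Prod.mk.injEq] at h
    rw [← h.1, ← h.2, Equiv.swap_apply_self, Equiv.swap_apply_self] at c2
    exact absurd hp c2
  · rw [Prod.mk.injEq] at h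
    rw [h.1, h.2, Equiv.swap_apply_self, Equiv.swap_apply_self] at c1
    exact absurd hq c1
  · exact h

theorem swapPair_mapsTo {u : Equiv.Perm (Fin n)} {a b : Fin n} (hab : a < b) (hu : u a < u b)
    {x y : Fin n} (hxy : x < y) (h : u y < u x) :
    (swapPair a b (x, y)).1 < (swapPair a b (x, y)).2 ∧
      (u * Equiv.swap a b) (swapPair a b (x, y)).2 <
        (u * Equiv.swap a b) (swapPair a b (x, y)).1 ∧ swapPair a b (x, y) ≠ (a, b) := by
  unfold swapPair
  simp only
  split_ifs with c
  · simp only [Equiv.Perm.mul_apply, Equiv.swap_apply_self, ne_eq, Prod.mk.injEq]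
    refine ⟨c, h, ?_⟩
    rintro ⟨h1, h2⟩
    rw [Equiv.swap_apply_eq_iff, Equiv.swap_apply_left] at h1
    rw [Equiv.swap_apply_eq_iff, Equiv.swap_apply_right] at h2
    subst h1; subst h2
    exact absurd hab (not_lt.2 hxy.le)
  · simp only [Equiv.Perm.mul_apply, ne_eq, Prod.mk.injEq]
    rcases swap_trichotomy a b x with ⟨h1, h2⟩ | ⟨h1, h2⟩ | ⟨h1, h1', h2⟩ <;>
    rcases swap_trichotomy a b y with ⟨h3, h4⟩ | ⟨h3, h4⟩ | ⟨h3, h3', h4⟩ <;>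
    rw [h2, h4] at c ⊢ <;> grind

theorem mem_image_swapPair {u : Equiv.Perm (Fin n)} {a b : Fin n} (hab : a < b)
    (hc : ∀ c, a < c → c < b → u a < u c → u c < u b → False) {x y : Fin n} (hxy : x < y)
    (h : (u * Equiv.swap a b) y < (u * Equiv.swap a b) x) (hne : (x, y) ≠ (a, b)) :
    ∃ p : Fin n × Fin n, (p.1 < p.2 ∧ u p.2 < u p.1) ∧ swapPair a b p = (x, y) := by
  simp only [Equiv.Perm.mul_apply] at h
  by_cases c : Equiv.swap a b x < Equiv.swap a b y
  · exact ⟨(Equiv.swap a b x, Equiv.swap a b y), ⟨c, h⟩, by simp [swapPair, hxy]⟩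
  · refine ⟨(x, y), ⟨hxy, ?_⟩, by simp [swapPair, c]⟩
    have hu : u x ≠ u y := fun e => hxy.ne (u.injective e)
    simp only [ne_eq, Prod.mk.injEq] at hne
    have := hc x
    have := hc y
    rcases swap_trichotomy a b x with ⟨h1, h2⟩ | ⟨h1, h2⟩ | ⟨h1, h1', h2⟩ <;>
    rcases swap_trichotomy a b y with ⟨h3, h4⟩ | ⟨h3, h4⟩ | ⟨h3, h3', h4⟩ <;>
    rw [h2, h4] at c h <;> grind

/-- Swapping two values that stand in increasing order adds at least one inversion. -/
theorem permLength_lt_swap {u : Equiv.Perm (Fin n)} {a b : Fin n} (hab : a < b)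
    (hu : u a < u b) : permLength u < permLength (u * Equiv.swap a b) := by
  unfold permLength
  rw [← Finset.card_image_of_injOn (f := swapPair a b)]
  · apply Finset.card_lt_card
    rw [Finset.ssubset_iff_of_subset]
    · refine ⟨(a, b), Finset.mem_filter.2 ⟨Finset.mem_univ _, hab, by simpa using hu⟩, ?_⟩
      simp only [Finset.mem_image, not_exists, not_and, Finset.mem_filter, Finset.mem_univ,
        true_and]
      rintro ⟨x, y⟩ ⟨h1, h2⟩
      exact (swapPair_mapsTo hab hu h1 h2).2.2
    · intro p hp
      simp only [Finset.mem_image, Finset.mem_filter, Finset.mem_univ, true_and] at hp ⊢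
      obtain ⟨⟨x, y⟩, ⟨h1, h2⟩, rfl⟩ := hp
      exact ⟨(swapPair_mapsTo hab hu h1 h2).1, (swapPair_mapsTo hab hu h1 h2).2.1⟩
  · intro p hp q hq
    simp only [Finset.coe_filter, Finset.mem_univ, true_and, Set.mem_ofPred_eq] at hp hq
    exact swapPair_injOn a b hp.1 hq.1

/-- The length grows by exactly one if no value at a position in between lies in between. -/
theorem permLength_swap_of_no_between {u : Equiv.Perm (Fin n)} {a b : Fin n} (hab : a < b)
    (hu : u a < u b) (hc : ∀ c, a < c → c < b → u a < u c → u c < u b → False) :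
    permLength (u * Equiv.swap a b) = permLength u + 1 := by
  apply le_antisymm _ (permLength_lt_swap hab hu)
  have h : (Finset.univ.filter fun p : Fin n × Fin n =>
      p.1 < p.2 ∧ (u * Equiv.swap a b) p.2 < (u * Equiv.swap a b) p.1) ⊆
      insert (a, b) ((Finset.univ.filter fun p : Fin n × Fin n =>
        p.1 < p.2 ∧ u p.2 < u p.1).image (swapPair a b)) := by
    rintro ⟨x, y⟩ hp
    simp only [Finset.mem_filter, Finset.mem_univ, true_and] at hp
    by_cases hne : (x, y) = (a, b)
    · rw [hne]; exact Finset.mem_insert_self _ _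
    · obtain ⟨q, hq, hq'⟩ := mem_image_swapPair hab hc hp.1 hp.2 hne
      exact Finset.mem_insert_of_mem (Finset.mem_image.2 ⟨q, by simpa using hq, hq'⟩)
  exact (Finset.card_le_card h).trans ((Finset.card_insert_le _ _).trans
    (Nat.add_le_add_right Finset.card_image_le 1))

theorem permLength_swap_lt {u : Equiv.Perm (Fin n)} {a b : Fin n} (hab : a < b)
    (hu : u b < u a) : permLength (u * Equiv.swap a b) < permLength u := by
  have h := permLength_lt_swap (u := u * Equiv.swap a b) hab (by simpa using hu)
  rwa [mul_assoc, Equiv.swap_mul_self, mul_one] at h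

theorem permLength_one : permLength (1 : Equiv.Perm (Fin n)) = 0 := by
  unfold permLength
  rw [Finset.card_eq_zero, Finset.filter_eq_empty_iff]
  rintro ⟨x, y⟩ - ⟨h1, h2⟩
  exact absurd h1 (not_lt.2 h2.le)

theorem permLength_le (u : Equiv.Perm (Fin n)) : permLength u ≤ n * n := by
  unfold permLength
  refine (Finset.card_le_univ _).trans ?_
  simp

theorem bruhatStep_iff {u w : Equiv.Perm (Fin n)} :
    BruhatStep u w ↔ ∃ a b : Fin n, a < b ∧ u a < u b ∧ w = u * Equiv.swap a b := by
  constructor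
  · rintro ⟨a, b, hab, rfl, hl⟩
    wlog h : a < b generalizing a b
    · have := this b a hab.symm (by rwa [Equiv.swap_comm]) (lt_of_le_of_ne (not_lt.1 h) hab.symm)
      rwa [Equiv.swap_comm]
    refine ⟨a, b, h, ?_, rfl⟩
    by_contra hu
    have hne : u a ≠ u b := fun e => hab (u.injective e)
    exact absurd hl (permLength_swap_lt h (lt_of_le_of_ne (not_lt.1 hu) hne.symm)).asymm
  · rintro ⟨a, b, hab, hu, rfl⟩
    exact ⟨a, b, hab.ne, rfl, permLength_lt_swap hab hu⟩

theorem bruhatLE_swap {u : Equiv.Perm (Fin n)} {a b : Fin n} (hab : a < b) (hu : u a < u b) :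
    BruhatLE u (u * Equiv.swap a b) :=
  Relation.ReflTransGen.single (bruhatStep_iff.2 ⟨a, b, hab, hu, rfl⟩)

theorem swap_bruhatLE {u : Equiv.Perm (Fin n)} {a b : Fin n} (hab : a < b) (hu : u b < u a) :
    BruhatLE (u * Equiv.swap a b) u := by
  have h := bruhatLE_swap (u := u * Equiv.swap a b) hab (by simpa using hu)
  rwa [mul_assoc, Equiv.swap_mul_self, mul_one] at h

theorem BruhatLE.eq_or_permLength_lt {u w : Equiv.Perm (Fin n)} (h : BruhatLE u w) :
    u = w ∨ permLength u < permLength w := by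
  induction h with
  | refl => exact Or.inl rfl
  | tail _ hs ih =>
    obtain ⟨_, _, _, _, hl⟩ := hs
    rcases ih with rfl | ih
    · exact Or.inr hl
    · exact Or.inr (ih.trans hl)

theorem BruhatLT.permLength_lt {u w : Equiv.Perm (Fin n)} (h : BruhatLT u w) :
    permLength u < permLength w :=
  h.1.eq_or_permLength_lt.resolve_left h.2

theorem bruhatCover_swap {u : Equiv.Perm (Fin n)} {a b : Fin n} (hab : a < b) (hu : u a < u b)
    (hc : ∀ c, a < c → c < b → u a < u c → u c < u b → False) :
    BruhatCover u (u * Equiv.swap a b) := by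
  have hl := permLength_swap_of_no_between hab hu hc
  refine ⟨⟨bruhatLE_swap hab hu, fun e => ?_⟩, fun v hv => ?_⟩
  · rw [← e] at hl; omega
  · have := hv.1.permLength_lt
    have := hv.2.permLength_lt
    omega

theorem BruhatCover.exists_swap {u w : Equiv.Perm (Fin n)} (h : BruhatCover u w) :
    ∃ a b : Fin n, a < b ∧ u a < u b ∧ w = u * Equiv.swap a b ∧
      ∀ c, a < c → c < b → u a < u c → u c < u b → False := by
  obtain ⟨⟨hle, hne⟩, hcov⟩ := h
  rcases Relation.ReflTransGen.cases_head hle with e | ⟨v, huv, hvw⟩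
  · exact absurd e hne
  obtain ⟨a, b, hab, hu, rfl⟩ := bruhatStep_iff.1 huv
  have hlt : BruhatLT u (u * Equiv.swap a b) :=
    ⟨bruhatLE_swap hab hu, fun e => by
      have := permLength_lt_swap hab hu; rw [← e] at this; exact lt_irrefl _ this⟩
  have hw : w = u * Equiv.swap a b := by
    by_contra hne'
    exact hcov _ ⟨hlt, hvw, fun e => hne' e.symm⟩
  refine ⟨a, b, hab, hu, hw, fun c hac hcb h1 h2 => ?_⟩
  -- `u < u (a c) < u (a c) (a b) < u (a c) (a b) (c b) = u (a b)`
  have s1 : BruhatStep u (u * Equiv.swap a c) := bruhatStep_iff.2 ⟨a, c, hac, h1, rfl⟩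
  have s2 : BruhatStep (u * Equiv.swap a c) (u * Equiv.swap a c * Equiv.swap a b) :=
    bruhatStep_iff.2 ⟨a, b, hab, by
      simp [Equiv.swap_apply_of_ne_of_ne hab.ne' hcb.ne', h2], rfl⟩
  have s3 : BruhatStep (u * Equiv.swap a c * Equiv.swap a b)
      (u * Equiv.swap a c * Equiv.swap a b * Equiv.swap c b) :=
    bruhatStep_iff.2 ⟨c, b, hcb, by
      simp [Equiv.swap_apply_of_ne_of_ne hac.ne' hcb.ne, h1], rfl⟩
  have e : u * Equiv.swap a c * Equiv.swap a b * Equiv.swap c b = w := by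
    rw [hw, mul_assoc, mul_assoc]
    congr 1
    ext x
    simp only [Equiv.Perm.mul_apply]
    congr 1
    have := hac.ne
    have := hcb.ne
    have := hab.ne
    simp only [Equiv.swap_apply_def]
    grind
  rw [e] at s3
  have l1 := s1.choose_spec.choose_spec.2.2
  have l2 := s2.choose_spec.choose_spec.2.2
  have l3 := s3.choose_spec.choose_spec.2.2
  refine hcov (u * Equiv.swap a c) ⟨⟨Relation.ReflTransGen.single s1, fun e' => ?_⟩,
    ⟨Relation.ReflTransGen.head s2 (Relation.ReflTransGen.single s3), fun e' => ?_⟩⟩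
  · rw [← e'] at l1; exact lt_irrefl _ l1
  · have l := l2.trans l3
    rw [e'] at l
    exact lt_irrefl _ l

end Finite

/-! ### The Bergeron–Sottile criterion for the `k`-Bruhat order -/

section Finite
variable {n : ℕ}

/-- Along `[u, w]_k` the values at the first `k` positions go up and the others go down. -/
def MovesUpDown (k : ℕ) (u w : Equiv.Perm (Fin n)) : Prop :=
  (∀ a : Fin n, (a : ℕ) < k → u a ≤ w a) ∧ ∀ b : Fin n, k ≤ (b : ℕ) → w b ≤ u b

/-- Two positions lie in the same block of `{1, …, k} ⊔ {k + 1, …, n}`. -/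
def SameBlock (k : ℕ) (a b : Fin n) : Prop := (a : ℕ) < k ↔ (b : ℕ) < k

/-- Within a block, values in increasing order in `u` are in increasing order in `w`. -/
def BlockMonotone (k : ℕ) (u w : Equiv.Perm (Fin n)) : Prop :=
  ∀ c d : Fin n, c < d → SameBlock k c d → u c < u d → w c < w d

/-- `w` is `k`-Grassmannian: increasing on each of the two blocks. -/
def Grassmannian (k : ℕ) (w : Equiv.Perm (Fin n)) : Prop :=
  ∀ c d : Fin n, c < d → SameBlock k c d → w c < w d

theorem Grassmannian.blockMonotone {k : ℕ} {w : Equiv.Perm (Fin n)} (h : Grassmannian k w)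
    (u : Equiv.Perm (Fin n)) : BlockMonotone k u w :=
  fun c d hcd hb _ => h c d hcd hb

theorem SameBlock.inParabolic_swap {k : ℕ} {a b : Fin n} (h : SameBlock k a b) :
    InParabolic k (Equiv.swap a b) := by
  intro x
  unfold SameBlock at h
  rcases swap_trichotomy a b x with ⟨rfl, h2⟩ | ⟨rfl, h2⟩ | ⟨-, -, h2⟩ <;> rw [h2]
  · exact h.symm
  · exact h

theorem sigma_mul_of_inParabolic {k : ℕ} (u : Equiv.Perm (Fin n)) {z : Equiv.Perm (Fin n)}
    (hz : InParabolic k z) : sigma k (u * z) = sigma k u := by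
  ext x
  simp only [sigma, Finset.mem_image, Finset.mem_filter, Finset.mem_univ, true_and]
  constructor
  · rintro ⟨a, ha, rfl⟩
    exact ⟨z a, (hz a).2 ha, rfl⟩
  · rintro ⟨a, ha, rfl⟩
    refine ⟨z⁻¹ a, (hz _).1 (by simpa using ha), by simp⟩

theorem sigma_swap_ne {k : ℕ} (u : Equiv.Perm (Fin n)) {a b : Fin n} (ha : (a : ℕ) < k)
    (hb : k ≤ (b : ℕ)) : sigma k u ≠ sigma k (u * Equiv.swap a b) := by
  intro h
  have h1 : u b ∈ sigma k (u * Equiv.swap a b) := by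
    simp only [sigma, Finset.mem_image, Finset.mem_filter, Finset.mem_univ, true_and]
    exact ⟨a, ha, by simp⟩
  rw [← h] at h1
  simp only [sigma, Finset.mem_image, Finset.mem_filter, Finset.mem_univ, true_and] at h1
  obtain ⟨c, hc, e⟩ := h1
  rw [u.injective e] at hc
  omega

theorem KBruhatCover.exists_swap {k : ℕ} {u w : Equiv.Perm (Fin n)} (h : KBruhatCover k u w) :
    ∃ a b : Fin n, (a : ℕ) < k ∧ k ≤ (b : ℕ) ∧ u a < u b ∧ w = u * Equiv.swap a b ∧
      ∀ c, a < c → c < b → u a < u c → u c < u b → False := by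
  obtain ⟨hcov, hs⟩ := h
  obtain ⟨a, b, hab, hu, rfl, hc⟩ := hcov.exists_swap
  have hb : ¬ SameBlock k a b := fun hb => hs (sigma_mul_of_inParabolic u hb.inParabolic_swap).symm
  have hab' : (a : ℕ) < b := hab
  unfold SameBlock at hb
  exact ⟨a, b, by omega, by omega, hu, rfl, hc⟩

theorem kBruhatCover_swap {k : ℕ} {u : Equiv.Perm (Fin n)} {a b : Fin n} (ha : (a : ℕ) < k)
    (hb : k ≤ (b : ℕ)) (hu : u a < u b)
    (hc : ∀ c, a < c → c < b → u a < u c → u c < u b → False) :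
    KBruhatCover k u (u * Equiv.swap a b) :=
  ⟨bruhatCover_swap (Fin.lt_def.2 (by omega)) hu hc, sigma_swap_ne u ha hb⟩

theorem KBruhatLE.movesUpDown_blockMonotone {k : ℕ} {u w : Equiv.Perm (Fin n)}
    (h : KBruhatLE k u w) : MovesUpDown k u w ∧ BlockMonotone k u w := by
  induction h using Relation.ReflTransGen.head_induction_on with
  | refl => exact ⟨⟨fun _ _ => le_rfl, fun _ _ => le_rfl⟩, fun _ _ _ _ h => h⟩
  | @head u v hs _ ih =>
    obtain ⟨a, b, ha, hb, hu, rfl, hc⟩ := hs.exists_swap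
    obtain ⟨⟨h1, h2⟩, h3⟩ := ih
    simp only [Equiv.Perm.mul_apply] at h1 h2
    refine ⟨⟨fun c hck => ?_, fun c hck => ?_⟩, fun c d hcd hcdb hucd => ?_⟩
    · have := h1 c hck
      rcases swap_trichotomy a b c with ⟨rfl, e⟩ | ⟨rfl, e⟩ | ⟨-, -, e⟩
      · rw [e] at this; exact hu.le.trans this
      · omega
      · rwa [e] at this
    · have := h2 c hck
      rcases swap_trichotomy a b c with ⟨rfl, e⟩ | ⟨rfl, e⟩ | ⟨-, -, e⟩
      · omega
      · rw [e] at this; exact this.trans hu.le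
      · rwa [e] at this
    · apply h3 c d hcd hcdb
      simp only [Equiv.Perm.mul_apply]
      have hcd' : (c : ℕ) < d := hcd
      have hcd0 := hucd.ne
      have h4 := hc c
      have h5 := hc d
      have h6 : u c ≠ u a ∨ c = a := by
        by_cases e : c = a
        · exact Or.inr e
        · exact Or.inl fun e' => e (u.injective e')
      have h7 : u d ≠ u b ∨ d = b := by
        by_cases e : d = b
        · exact Or.inr e
        · exact Or.inl fun e' => e (u.injective e')
      unfold SameBlock at hcdb
      rcases swap_trichotomy a b c with ⟨h1, e1⟩ | ⟨h1, e1⟩ | ⟨h1, h1', e1⟩ <;>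
      rcases swap_trichotomy a b d with ⟨h2, e2⟩ | ⟨h2, e2⟩ | ⟨h2, h2', e2⟩ <;>
      rw [e1, e2] <;> grind

/-- If values move up in the first block and down in the second, and something moves, some swap
across the blocks is still to be done. -/
theorem MovesUpDown.exists_pair {k : ℕ} {u w : Equiv.Perm (Fin n)} (h : MovesUpDown k u w)
    (hne : u ≠ w) : ∃ a b : Fin n, (a : ℕ) < k ∧ k ≤ (b : ℕ) ∧ u a < u b ∧ u b ≤ w a ∧
      w b ≤ u a := by
  have hA : (Finset.univ.filter fun a : Fin n => (a : ℕ) < k ∧ u a < w a).Nonempty := by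
    by_contra hA
    rw [Finset.not_nonempty_iff_eq_empty, Finset.filter_eq_empty_iff] at hA
    have hle : ∀ i ∈ Finset.univ, ((w i : Fin n) : ℕ) ≤ u i := by
      intro i _
      by_cases hi : (i : ℕ) < k
      · exact not_lt.1 fun hlt => hA (Finset.mem_univ i) ⟨hi, hlt⟩
      · exact h.2 i (not_lt.1 hi)
    have hsum : ∑ i, ((w i : Fin n) : ℕ) = ∑ i, ((u i : Fin n) : ℕ) := by
      rw [Equiv.sum_comp w (fun i : Fin n => (i : ℕ)), Equiv.sum_comp u (fun i : Fin n => (i : ℕ))]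
    rw [Finset.sum_eq_sum_iff_of_le hle] at hsum
    exact hne (Equiv.ext fun i => (Fin.ext (hsum i (Finset.mem_univ i))).symm)
  -- among the moving positions of the first block, `a` has the largest value in `u`
  obtain ⟨a, ha, hmax⟩ := Finset.exists_max_image _ (fun a => u a) hA
  simp only [Finset.mem_filter, Finset.mem_univ, true_and] at ha hmax
  obtain ⟨hak, hua⟩ := ha
  have hfix : ∀ c : Fin n, (c : ℕ) < k → u a < u c → u c = w c := fun c hc hlt =>
    le_antisymm (h.1 c hc) (not_lt.1 fun hlt' => absurd hlt (not_lt.2 (hmax c ⟨hc, hlt'⟩)))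
  -- the position of the value `w a` in `u` is a candidate for `b`
  have hB : (Finset.univ.filter fun b : Fin n =>
      k ≤ (b : ℕ) ∧ u a < u b ∧ u b ≤ w a ∧ w b < u b).Nonempty := by
    have e : u (u⁻¹ (w a)) = w a := by simp
    refine ⟨u⁻¹ (w a), ?_⟩
    generalize u⁻¹ (w a) = c at e
    have hca : c ≠ a := fun e' => by rw [e'] at e; exact hua.ne e
    have hck : k ≤ (c : ℕ) := by
      by_contra hck
      exact hca (w.injective ((hfix c (not_le.1 hck) (by rw [e]; exact hua)).symm.trans e))
    simp only [Finset.mem_filter, Finset.mem_univ, true_and]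
    refine ⟨hck, by rw [e]; exact hua, e.le, lt_of_le_of_ne (h.2 c hck) fun e' => ?_⟩
    exact hca (w.injective (e'.trans e))
  -- if `w b` were above `u a`, the position of this value in `u` would be a smaller choice of `b`
  obtain ⟨b, hb, hmin⟩ := Finset.exists_min_image _ (fun b => u b) hB
  simp only [Finset.mem_filter, Finset.mem_univ, true_and] at hb hmin
  obtain ⟨hbk, hab, hba, hwb⟩ := hb
  refine ⟨a, b, hak, hbk, hab, hba, ?_⟩
  by_contra hlt
  rw [not_le] at hlt
  have e : u (u⁻¹ (w b)) = w b := by simp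
  generalize u⁻¹ (w b) = d at e
  have hdb : d ≠ b := fun e' => by rw [e'] at e; exact hwb.ne e.symm
  have hdk : k ≤ (d : ℕ) := by
    by_contra hdk
    exact hdb (w.injective ((hfix d (not_le.1 hdk) (by rw [e]; exact hlt)).symm.trans e))
  have := hmin d ⟨hdk, by rw [e]; exact hlt, by rw [e]; exact hwb.le.trans hba,
    lt_of_le_of_ne (h.2 d hdk) fun e' => hdb (w.injective (e'.trans e))⟩
  rw [e] at this
  exact absurd hwb (not_lt.2 this)

/-- The step of the Bergeron–Sottile criterion: the closest pair of values that may be swapped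
gives a cover, and both conditions of the criterion survive. -/
theorem MovesUpDown.exists_cover {k : ℕ} {u w : Equiv.Perm (Fin n)} (h : MovesUpDown k u w)
    (hm : BlockMonotone k u w) (hne : u ≠ w) :
    ∃ v, KBruhatCover k u v ∧ MovesUpDown k v w ∧ BlockMonotone k v w := by
  obtain ⟨a₀, b₀, hP₀⟩ := h.exists_pair hne
  obtain ⟨⟨a, b⟩, hp, hmin⟩ := Finset.exists_min_image
    (Finset.univ.filter fun p : Fin n × Fin n => (p.1 : ℕ) < k ∧ k ≤ (p.2 : ℕ) ∧
      u p.1 < u p.2 ∧ u p.2 ≤ w p.1 ∧ w p.2 ≤ u p.1) (fun p => ((u p.2 : ℕ) - (u p.1 : ℕ)))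
    ⟨(a₀, b₀), by simpa using hP₀⟩
  simp only [Finset.mem_filter, Finset.mem_univ, true_and, Prod.forall] at hp hmin
  obtain ⟨hak, hbk, hab, hba, hwb⟩ := hp
  have H1 : ∀ c : Fin n, (c : ℕ) < k → u a < u c → u c < u b → w c < w a := by
    intro c hc h1 h2
    by_contra hlt
    have := hmin c b ⟨hc, hbk, h2, hba.trans (not_lt.1 hlt), hwb.trans h1.le⟩
    rw [Fin.lt_def] at h1 h2 hab
    omega
  have H2 : ∀ c : Fin n, k ≤ (c : ℕ) → u a < u c → u c < u b → w b < w c := by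
    intro c hc h1 h2
    by_contra hlt
    have := hmin a c ⟨hak, hc, h1, h2.le.trans hba, (not_lt.1 hlt).trans hwb⟩
    rw [Fin.lt_def] at h1 h2 hab
    omega
  refine ⟨u * Equiv.swap a b, kBruhatCover_swap hak hbk hab fun c hac hcb h1 h2 => ?_,
    ⟨fun c hc => ?_, fun c hc => ?_⟩, fun c d hcd hb huv => ?_⟩
  · by_cases hc : (c : ℕ) < k
    · exact (H1 c hc h1 h2).asymm (hm a c hac (iff_of_true hak hc) h1)
    · exact (H2 c (not_lt.1 hc) h1 h2).asymm
        (hm c b hcb (iff_of_false hc (not_lt.2 hbk)) h2)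
  · rw [Equiv.Perm.mul_apply]
    rcases swap_trichotomy a b c with ⟨rfl, e⟩ | ⟨rfl, e⟩ | ⟨-, -, e⟩ <;> rw [e]
    · exact hba
    · omega
    · exact h.1 c hc
  · rw [Equiv.Perm.mul_apply]
    rcases swap_trichotomy a b c with ⟨rfl, e⟩ | ⟨rfl, e⟩ | ⟨-, -, e⟩ <;> rw [e]
    · omega
    · exact hwb
    · exact h.2 c hc
  · rw [Equiv.Perm.mul_apply, Equiv.Perm.mul_apply] at huv
    have h1 := hm c d hcd hb
    have h2 := H1 c
    have h3 := H2 d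
    have h6 : u c ≠ u a ∨ c = a := by
      by_cases e : c = a
      · exact Or.inr e
      · exact Or.inl fun e' => e (u.injective e')
    have h7 : u d ≠ u b ∨ d = b := by
      by_cases e : d = b
      · exact Or.inr e
      · exact Or.inl fun e' => e (u.injective e')
    unfold SameBlock at hb
    rcases swap_trichotomy a b c with ⟨h1, e1⟩ | ⟨h1, e1⟩ | ⟨h1, h1', e1⟩ <;>
    rcases swap_trichotomy a b d with ⟨h2, e2⟩ | ⟨h2, e2⟩ | ⟨h2, h2', e2⟩ <;>
    rw [e1, e2] at huv <;> grind

/-- The Bergeron–Sottile criterion for the `k`-Bruhat order. -/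
theorem kBruhatLE_iff {k : ℕ} {u w : Equiv.Perm (Fin n)} :
    KBruhatLE k u w ↔ MovesUpDown k u w ∧ BlockMonotone k u w := by
  refine ⟨KBruhatLE.movesUpDown_blockMonotone, fun h => ?_⟩
  induction hN : n * n - permLength u using Nat.strong_induction_on generalizing u with
  | _ N ih =>
    by_cases hne : u = w
    · rw [hne]; exact Relation.ReflTransGen.refl
    · obtain ⟨v, hv, h'⟩ := h.1.exists_cover h.2 hne
      have := hv.1.1.permLength_lt
      have := permLength_le v
      exact Relation.ReflTransGen.head hv (ih _ (by omega) h' rfl)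

theorem KBruhatLE.bruhatLE {k : ℕ} {u w : Equiv.Perm (Fin n)} (h : KBruhatLE k u w) :
    BruhatLE u w := by
  induction h with
  | refl => exact Relation.ReflTransGen.refl
  | tail _ hs ih => exact ih.trans hs.1.1.1

/-- Below a Grassmannian permutation, Bruhat order and `k`-Bruhat order agree. -/
theorem BruhatLE.kBruhatLE {k : ℕ} {u w : Equiv.Perm (Fin n)} (h : BruhatLE u w)
    (hw : Grassmannian k w) : KBruhatLE k u w := by
  -- for Grassmannian `w` this stronger bound holds, and it passes down Bruhat steps
  have key : (∀ i c : Fin n, i ≤ c → (c : ℕ) < k → u i ≤ w c) ∧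
      ∀ i c : Fin n, c ≤ i → k ≤ (c : ℕ) → w c ≤ u i := by
    induction h using Relation.ReflTransGen.head_induction_on with
    | refl =>
      refine ⟨fun i c hi hc => ?_, fun i c hi hc => ?_⟩
      · rcases hi.eq_or_lt with rfl | hi'
        · exact le_rfl
        · exact (hw i c hi' (iff_of_true (lt_of_le_of_lt hi hc) hc)).le
      · rcases hi.eq_or_lt with rfl | hi'
        · exact le_rfl
        · exact (hw c i hi' (iff_of_false (not_lt.2 hc) (not_lt.2 (hc.trans hi)))).le
    | @head u v hs _ ih =>
      obtain ⟨a, b, hab, hu, rfl⟩ := bruhatStep_iff.1 hs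
      obtain ⟨h1, h2⟩ := ih
      simp only [Equiv.Perm.mul_apply] at h1 h2
      refine ⟨fun i c hi hc => ?_, fun i c hi hc => ?_⟩
      · rcases swap_trichotomy a b i with ⟨rfl, e⟩ | ⟨rfl, e⟩ | ⟨-, -, e⟩
        · have := h1 i c hi hc
          rw [e] at this
          exact hu.le.trans this
        · simpa using h1 a c (hab.le.trans hi) hc
        · simpa [e] using h1 i c hi hc
      · rcases swap_trichotomy a b i with ⟨rfl, e⟩ | ⟨rfl, e⟩ | ⟨-, -, e⟩
        · simpa using h2 b c (hi.trans hab.le) hc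
        · have := h2 i c hi hc
          rw [e] at this
          exact this.trans hu.le
        · simpa [e] using h2 i c hi hc
  exact kBruhatLE_iff.2 ⟨⟨fun a ha => key.1 a a le_rfl ha, fun b hb => key.2 b b le_rfl hb⟩,
    hw.blockMonotone u⟩

end Finite

/-! ### Lifting and Grassmannian representatives -/

section Finite
variable {n : ℕ}

theorem adjacent_swap_lt {i j : Fin n} (hij : (j : ℕ) = i + 1) {a b : Fin n} (hab : a < b)
    (hne : ¬ (a = i ∧ b = j)) : Equiv.swap i j a < Equiv.swap i j b := by
  rcases swap_trichotomy i j a with ⟨h1, e1⟩ | ⟨h1, e1⟩ | ⟨h1, h1', e1⟩ <;>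
  rcases swap_trichotomy i j b with ⟨h2, e2⟩ | ⟨h2, e2⟩ | ⟨h2, h2', e2⟩ <;>
  rw [e1, e2] <;> grind

/-- A Bruhat step stays a step after multiplication by a simple transposition `s`, unless it is
multiplication by `s`. -/
theorem BruhatStep.mul_simple {x y : Equiv.Perm (Fin n)} (h : BruhatStep x y) {i j : Fin n}
    (hij : (j : ℕ) = i + 1) :
    y = x * Equiv.swap i j ∨ BruhatStep (x * Equiv.swap i j) (y * Equiv.swap i j) := by
  obtain ⟨a, b, hab, hx, rfl⟩ := bruhatStep_iff.1 h
  by_cases hne : a = i ∧ b = j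
  · rw [hne.1, hne.2]; exact Or.inl rfl
  · refine Or.inr (bruhatStep_iff.2 ⟨_, _, adjacent_swap_lt hij hab hne, by simpa using hx, ?_⟩)
    rw [Equiv.swap_apply_apply, Equiv.swap_inv]
    simp only [mul_assoc, Equiv.swap_mul_self_mul]

/-- The lifting property of Bruhat order, in a form that covers all descent patterns. -/
theorem BruhatLE.lifting {x y : Equiv.Perm (Fin n)} (h : BruhatLE x y) {i j : Fin n}
    (hij : (j : ℕ) = i + 1) :
    BruhatLE (x * Equiv.swap i j) (y * Equiv.swap i j) ∨
      (BruhatLE (x * Equiv.swap i j) y ∧ BruhatLE x (y * Equiv.swap i j)) := by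
  induction h using Relation.ReflTransGen.head_induction_on with
  | refl => exact Or.inl Relation.ReflTransGen.refl
  | @head x x₁ hs hle ih =>
    rcases hs.mul_simple hij with rfl | hs'
    · rw [mul_assoc, Equiv.swap_mul_self, mul_one] at ih
      refine Or.inr ⟨hle, ih.elim id fun ih => Relation.ReflTransGen.head hs ih.2⟩
    · exact ih.imp (Relation.ReflTransGen.head hs') fun ih =>
        ⟨Relation.ReflTransGen.head hs' ih.1, Relation.ReflTransGen.head hs ih.2⟩

theorem permLength_mul_simple {u : Equiv.Perm (Fin n)} {i j : Fin n} (hij : (j : ℕ) = i + 1)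
    (hu : u i < u j) : permLength (u * Equiv.swap i j) = permLength u + 1 :=
  permLength_swap_of_no_between (Fin.lt_def.2 (by omega)) hu fun c h1 h2 _ _ => by
    rw [Fin.lt_def] at h1 h2; omega

theorem permLength_simple {i j : Fin n} (hij : (j : ℕ) = i + 1) :
    permLength (Equiv.swap i j) = 1 := by
  have h := permLength_mul_simple (u := 1) hij (Fin.lt_def.2 (by simp [hij]))
  rwa [one_mul, permLength_one] at h

theorem grassmannian_of_adjacent {k : ℕ} {w : Equiv.Perm (Fin n)}
    (h : ∀ i j : Fin n, (j : ℕ) = i + 1 → SameBlock k i j → w i < w j) : Grassmannian k w := by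
  intro c d hcd hb
  rw [Fin.lt_def] at hcd
  unfold SameBlock at h hb
  induction hm : (d : ℕ) - c using Nat.strong_induction_on generalizing d with
  | _ m ih =>
    have hd := d.isLt
    let e : Fin n := ⟨d - 1, by omega⟩
    have he : (e : ℕ) = d - 1 := rfl
    have h1 : w e < w d := h e d (by omega) (by omega)
    by_cases hce : c = e
    · rw [hce]; exact h1
    · have hce' : (c : ℕ) ≠ e := fun e' => hce (Fin.ext e')
      exact (ih _ (by omega) e (by omega) (by omega) rfl).trans h1

/-- At a simple descent of `w` within a block, `u` has a descent too, and both may be removed. -/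
theorem KBruhatLE.mul_simple {k : ℕ} {u w : Equiv.Perm (Fin n)} (h : KBruhatLE k u w)
    {i j : Fin n} (hij : (j : ℕ) = i + 1) (hb : SameBlock k i j) (hw : w j < w i) :
    u j < u i ∧ KBruhatLE k (u * Equiv.swap i j) (w * Equiv.swap i j) := by
  obtain ⟨h1, h2⟩ := kBruhatLE_iff.1 h
  have hlt : i < j := Fin.lt_def.2 (by omega)
  have hu : u j < u i := by
    by_contra hu
    have hne : u i ≠ u j := fun e => hlt.ne (u.injective e)
    exact (h2 i j hlt hb (lt_of_le_of_ne (not_lt.1 hu) hne)).asymm hw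
  have hz := hb.inParabolic_swap
  refine ⟨hu, kBruhatLE_iff.2 ⟨⟨fun a ha => h1.1 _ ((hz a).2 ha),
    fun b hb' => h1.2 _ (not_lt.1 fun hlt => not_lt.2 hb' ((hz b).1 hlt))⟩, ?_⟩⟩
  intro c d hcd hcdb huv
  by_cases hne : c = i ∧ d = j
  · rw [hne.1, hne.2]; simpa using hw
  · refine h2 _ _ (adjacent_swap_lt hij hcd hne) ?_ huv
    exact (hz c).trans (hcdb.trans (hz d).symm)

/-- The interval obtained by removing a simple descent of the upper end from both ends. -/
def KBruhatInterval.mulSimple {k : ℕ} (I : KBruhatInterval k n) {i j : Fin n}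
    (hij : (j : ℕ) = i + 1) (hb : SameBlock k i j) (hw : I.w j < I.w i) : KBruhatInterval k n :=
  ⟨I.u * Equiv.swap i j, I.w * Equiv.swap i j, (I.le.mul_simple hij hb hw).2⟩

theorem KBruhatInterval.mk_mulSimple {k : ℕ} (I : KBruhatInterval k n) {i j : Fin n}
    (hij : (j : ℕ) = i + 1) (hb : SameBlock k i j) (hw : I.w j < I.w i) :
    Q.mk (I.mulSimple hij hb hw) = Q.mk I := by
  refine Quotient.sound (Relation.EqvGen.rel _ _ ⟨Equiv.swap i j, hb.inParabolic_swap, ?_⟩)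
  have hu := (I.le.mul_simple hij hb hw).1
  have e : ∀ x : Equiv.Perm (Fin n), x = x * Equiv.swap i j * Equiv.swap i j := fun x => by
    rw [mul_assoc, Equiv.swap_mul_self, mul_one]
  refine ⟨e _, ?_, e _, ?_⟩
  · conv_lhs => rw [e I.u]
    rw [permLength_simple hij]
    exact permLength_mul_simple hij (by simpa using hu)
  · conv_lhs => rw [e I.w]
    rw [permLength_simple hij]
    exact permLength_mul_simple hij (by simpa using hw)

theorem exists_block_descent {k : ℕ} {w : Equiv.Perm (Fin n)} (h : ¬ Grassmannian k w) :
    ∃ i j : Fin n, (j : ℕ) = i + 1 ∧ SameBlock k i j ∧ w j < w i := by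
  by_contra hne
  refine h (grassmannian_of_adjacent fun i j hij hb => ?_)
  by_contra hw
  have hw' : w i ≠ w j := fun e => by have := w.injective e; subst this; omega
  exact hne ⟨i, j, hij, hb, lt_of_le_of_ne (not_lt.1 hw) hw'.symm⟩

/-- A containment of Bruhat intervals can be carried to representatives of the same classes for
which the upper end of the larger interval is Grassmannian. -/
theorem exists_grassmannian_of_le {k : ℕ} (I' I : KBruhatInterval k n)
    (hu : BruhatLE I'.u I.u) (hw : BruhatLE I.w I'.w) :
    ∃ J' J : KBruhatInterval k n, Q.mk J' = Q.mk I' ∧ Q.mk J = Q.mk I ∧ Grassmannian k J'.w ∧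
      BruhatLE J'.u J.u ∧ BruhatLE J.w J'.w := by
  induction hm : permLength I'.w using Nat.strong_induction_on generalizing I' I with
  | _ m ih =>
    by_cases hg : Grassmannian k I'.w
    · exact ⟨I', I, rfl, rfl, hg, hu, hw⟩
    obtain ⟨i, j, hij, hb, hd⟩ := exists_block_descent hg
    have hlt : i < j := Fin.lt_def.2 (by omega)
    have hd' := (I'.le.mul_simple hij hb hd).1
    have hl : permLength (I'.mulSimple hij hb hd).w < m := hm ▸ permLength_swap_lt hlt hd
    have eI' := I'.mk_mulSimple hij hb hd
    have hu' := swap_bruhatLE hlt hd'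
    by_cases hwd : I.w j < I.w i
    · obtain ⟨J', J, h1, h2, h3⟩ := ih _ hl (I'.mulSimple hij hb hd) (I.mulSimple hij hb hwd)
        ((hu.lifting hij).elim id fun h => hu'.trans h.2)
        ((hw.lifting hij).elim id fun h => (swap_bruhatLE hlt hwd).trans h.2) rfl
      exact ⟨J', J, h1.trans eI', h2.trans (I.mk_mulSimple hij hb hwd), h3⟩
    · have hne : I.w i ≠ I.w j := fun e => hlt.ne (I.w.injective e)
      have hwa : I.w i < I.w j := lt_of_le_of_ne (not_lt.1 hwd) hne
      obtain ⟨J', J, h1, h2, h3⟩ := ih _ hl (I'.mulSimple hij hb hd) I (hu'.trans hu)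
        ((hw.lifting hij).elim (bruhatLE_swap hlt hwa).trans fun h => h.2) rfl
      exact ⟨J', J, h1.trans eI', h2, h3⟩

theorem exists_grassmannian {k : ℕ} (I : KBruhatInterval k n) :
    ∃ J : KBruhatInterval k n, Q.mk J = Q.mk I ∧ Grassmannian k J.w :=
  let ⟨J, _, h, _, hg, _⟩ := exists_grassmannian_of_le I I Relation.ReflTransGen.refl
    Relation.ReflTransGen.refl
  ⟨J, h, hg⟩

/-- If values move up in the first block and down in the second, a common rearrangement `z`
within the blocks turns `(u, w)` into a `k`-Bruhat interval whose Bruhat interval is smaller. -/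
theorem MovesUpDown.exists_kBruhatLE {k : ℕ} {u w : Equiv.Perm (Fin n)} (h : MovesUpDown k u w) :
    ∃ z : Equiv.Perm (Fin n), InParabolic k z ∧ KBruhatLE k (u * z) (w * z) ∧
      BruhatLE u (u * z) ∧ BruhatLE (w * z) w := by
  induction hm : permLength w using Nat.strong_induction_on generalizing u w with
  | _ m ih =>
    by_cases hbm : BlockMonotone k u w
    · exact ⟨1, fun a => by simp, by simpa using kBruhatLE_iff.2 ⟨h, hbm⟩,
        by rw [mul_one]; exact Relation.ReflTransGen.refl, by rw [mul_one]; exact Relation.ReflTransGen.refl⟩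
    simp only [BlockMonotone, not_forall] at hbm
    obtain ⟨c, d, hcd, hb, hu, hw⟩ := hbm
    have hw' : w d < w c :=
      lt_of_le_of_ne (not_lt.1 hw) fun e => hcd.ne' (w.injective e)
    have hz := hb.inParabolic_swap
    obtain ⟨z, h1, h2, h3, h4⟩ := ih _ (hm ▸ permLength_swap_lt hcd hw')
      (u := u * Equiv.swap c d) (w := w * Equiv.swap c d)
      ⟨fun a ha => h.1 _ ((hz a).2 ha),
        fun b hb' => h.2 _ (not_lt.1 fun hlt => not_lt.2 hb' ((hz b).1 hlt))⟩ rfl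
    refine ⟨Equiv.swap c d * z, fun a => (hz (z a)).trans (h1 a), ?_, ?_, ?_⟩ <;>
      rw [← mul_assoc]
    · rwa [← mul_assoc]
    · exact (bruhatLE_swap hcd hu).trans h3
    · exact h4.trans (swap_bruhatLE hcd hw')

theorem bruhatInterval_subset_iff {u w u' w' : Equiv.Perm (Fin n)} (h : BruhatLE u w) :
    bruhatInterval u w ⊆ bruhatInterval u' w' ↔ BruhatLE u' u ∧ BruhatLE w w' :=
  ⟨fun hs => ⟨(hs ⟨Relation.ReflTransGen.refl, h⟩).1, (hs ⟨h, Relation.ReflTransGen.refl⟩).2⟩,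
    fun hs _ hv => ⟨hs.1.trans hv.1, hv.2.trans hs.2⟩⟩

/-- Two Grassmannian permutations with the same image of the first block agree: an increasing
permutation of `Fin n` is the identity. -/
theorem Grassmannian.eq_of_inParabolic {k : ℕ} {w w' : Equiv.Perm (Fin n)}
    (h : Grassmannian k w) (h' : Grassmannian k w') (hz : InParabolic k (w'⁻¹ * w)) : w = w' := by
  have hmono : StrictMono (w'⁻¹ * w : Equiv.Perm (Fin n)) := by
    intro c d hcd
    have hc := hz c
    have hd := hz d
    by_cases hb : SameBlock k c d
    · by_contra hlt
      have hne : (w'⁻¹ * w) d ≠ (w'⁻¹ * w) c := fun e => hcd.ne' ((w'⁻¹ * w).injective e)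
      have := h' _ _ (lt_of_le_of_ne (not_lt.1 hlt) hne) (hd.trans (hb.symm.trans hc.symm))
      have e' : ∀ x, w' (w'⁻¹ x) = x := w'.apply_symm_apply
      simp only [Equiv.Perm.mul_apply, e'] at this
      exact this.asymm (h c d hcd hb)
    · unfold SameBlock at hb
      rw [Fin.lt_def] at hcd ⊢
      omega
  have hid : ((w'⁻¹ * w : Equiv.Perm (Fin n)) : Fin n → Fin n) = id :=
    (hmono.range_inj strictMono_id).1
      (by rw [(w'⁻¹ * w).surjective.range_eq, Set.range_id])
  have : w'⁻¹ * w = 1 := Equiv.ext fun x => congrFun hid x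
  rwa [inv_mul_eq_one, eq_comm] at this

end Finite

/-! ### Reflections and lengths in the affine symmetric group -/

section Affine
variable {n : ℕ}

theorem affinePerm_ext {f g : AffinePerm n} (h : ∀ m, f.1 m = g.1 m) : f = g :=
  Subtype.ext (Equiv.ext h)

theorem affinePerm_add_mul (f : AffinePerm n) (i r : ℤ) : f.1 (i + r * n) = f.1 i + r * n := by
  induction r using Int.induction_on with
  | zero => simp
  | succ r ih =>
    rw [show i + ((r : ℤ) + 1) * n = i + r * n + n by ring, f.2, ih]; ring
  | pred r ih =>
    have h := f.2 (i + (-(r : ℤ) - 1) * n)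
    rw [show i + (-(r : ℤ) - 1) * n + n = i + -(r : ℤ) * n by ring, ih] at h
    linarith

theorem exists_add_mul_of_modEq {m i : ℤ} (h : m ≡ i [ZMOD n]) : ∃ r : ℤ, m = i + r * n := by
  obtain ⟨r, hr⟩ := h.symm.dvd
  exact ⟨r, by linarith [mul_comm r (n : ℤ)]⟩

/-- `g` arises from `f` by swapping the values at the positions `i < j`, and at all their
translates, where `f i < f j`. -/
def SwapUp (f g : AffinePerm n) (i j : ℤ) : Prop :=
  i < j ∧ ¬ (i ≡ j [ZMOD n]) ∧ f.1 i < f.1 j ∧ g.1 i = f.1 j ∧ g.1 j = f.1 i ∧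
    ∀ m : ℤ, ¬ (m ≡ i [ZMOD n]) → ¬ (m ≡ j [ZMOD n]) → g.1 m = f.1 m

theorem IsAffineTransposition.trichotomy {i j : ℤ} {t : AffinePerm n}
    (ht : IsAffineTransposition i j t) (f : AffinePerm n) (hf : f.1 i < f.1 j) (m : ℤ) :
    (t.1 m = m + (j - i) ∧ f.1 m < f.1 (t.1 m)) ∨ (t.1 m = m - (j - i) ∧ f.1 (t.1 m) < f.1 m) ∨
      t.1 m = m := by
  obtain ⟨-, h1, h2, h3⟩ := ht
  by_cases hi : m ≡ i [ZMOD n]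
  · obtain ⟨r, rfl⟩ := exists_add_mul_of_modEq hi
    rw [h1, affinePerm_add_mul, affinePerm_add_mul]
    exact Or.inl ⟨by ring, by linarith⟩
  by_cases hj : m ≡ j [ZMOD n]
  · obtain ⟨r, rfl⟩ := exists_add_mul_of_modEq hj
    rw [h2, affinePerm_add_mul, affinePerm_add_mul]
    exact Or.inr (Or.inl ⟨by ring, by linarith⟩)
  · exact Or.inr (Or.inr (h3 m hi hj))

theorem IsAffineTransposition.apply_self {i j : ℤ} {t : AffinePerm n}
    (ht : IsAffineTransposition i j t) (m : ℤ) : t.1 (t.1 m) = m := by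
  obtain ⟨-, h1, h2, h3⟩ := ht
  by_cases hi : m ≡ i [ZMOD n]
  · obtain ⟨r, rfl⟩ := exists_add_mul_of_modEq hi
    rw [h1, h2]
  by_cases hj : m ≡ j [ZMOD n]
  · obtain ⟨r, rfl⟩ := exists_add_mul_of_modEq hj
    rw [h2, h1]
  · rw [h3 m hi hj, h3 m hi hj]

/-- The affine analogue of `swapPair`. -/
def affineSwapPair (t : AffinePerm n) (p : ℤ × ℤ) : ℤ × ℤ :=
  if t.1 p.1 < t.1 p.2 then (t.1 p.1, t.1 p.2) else p

theorem affineSwapPair_mapsTo {f : AffinePerm n} {i j : ℤ} (hij : i < j) {t : AffinePerm n}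
    (ht : IsAffineTransposition i j t) (hf : f.1 i < f.1 j) {p : ℤ × ℤ}
    (hp1 : p.1 < p.2) (hp2 : f.1 p.2 < f.1 p.1) :
    (affineSwapPair t p).1 < (affineSwapPair t p).2 ∧
      (f * t).1 (affineSwapPair t p).2 < (f * t).1 (affineSwapPair t p).1 := by
  simp only [Subgroup.coe_mul, Equiv.Perm.mul_apply]
  unfold affineSwapPair
  split_ifs with h
  · exact ⟨h, by simpa [ht.apply_self] using hp2⟩
  · refine ⟨hp1, ?_⟩
    have hne : t.1 p.1 ≠ t.1 p.2 := fun e => hp1.ne (t.1.injective e)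
    rcases ht.trichotomy f hf p.1 with ⟨e, h1⟩ | ⟨e, h1⟩ | e <;>
    rcases ht.trichotomy f hf p.2 with ⟨e', h1'⟩ | ⟨e', h1'⟩ | e' <;>
    first
    | (exfalso; omega)
    | (rw [e, e'] at *; omega)

/-- The map on inversions given by `affineSwapPair`. -/
def swapInversion {f : AffinePerm n} {i j : ℤ} (hij : i < j) {t : AffinePerm n}
    (ht : IsAffineTransposition i j t) (hf : f.1 i < f.1 j)
    (p : AffineInversion f) : AffineInversion (f * t) :=
  ⟨affineSwapPair t p.1, affineSwapPair_mapsTo hij ht hf p.2.1 p.2.2⟩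

theorem affineSwapPair_injective_mod {i j : ℤ} {t : AffinePerm n}
    (ht : IsAffineTransposition i j t) {p q : ℤ × ℤ} (hp : p.1 < p.2) (hq : q.1 < q.2) {r : ℤ}
    (h1 : (affineSwapPair t q).1 = (affineSwapPair t p).1 + r * n)
    (h2 : (affineSwapPair t q).2 = (affineSwapPair t p).2 + r * n) :
    q.1 = p.1 + r * n ∧ q.2 = p.2 + r * n := by
  have e1 := ht.apply_self p.1
  have e2 := ht.apply_self p.2
  have e3 := ht.apply_self q.1
  have e4 := ht.apply_self q.2
  unfold affineSwapPair at h1 h2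
  split_ifs at h1 h2 with c1 c2 c2
  · simp only at h1 h2
    rw [h1, affinePerm_add_mul, e1] at e3
    rw [h2, affinePerm_add_mul, e2] at e4
    exact ⟨e3.symm, e4.symm⟩
  · simp only at h1 h2
    rw [h1, affinePerm_add_mul] at e3
    rw [h2, affinePerm_add_mul] at e4
    omega
  · simp only at h1 h2
    rw [h1, h2, affinePerm_add_mul, affinePerm_add_mul, e1, e2] at c1
    omega
  · exact ⟨h1, h2⟩

/-- Affine lengths are finite, so that `affineLength`, defined by `Nat.card`, really counts: as
`f m - m` is bounded, every class of inversions meets a finite box. -/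
theorem finite_affineInversion_quotient [NeZero n] (f : AffinePerm n) :
    Finite (Quotient (affineInversionSetoid f)) := by
  have hn : (0 : ℤ) < n := by exact_mod_cast NeZero.pos n
  obtain ⟨M, hM⟩ : ∃ M : ℤ, ∀ m, |f.1 m - m| ≤ M := by
    refine ⟨∑ m ∈ Finset.Ico (0 : ℤ) n, |f.1 m - m|, fun m => ?_⟩
    have h1 : f.1 m - m = f.1 (m % n) - m % n := by
      have h := affinePerm_add_mul f (m % n) (m / n)
      rw [mul_comm, Int.emod_add_mul_ediv] at h
      have := Int.emod_add_mul_ediv m n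
      rw [h]; linarith
    rw [h1]
    exact Finset.single_le_sum (f := fun m => |f.1 m - m|) (fun _ _ => abs_nonneg _)
      (Finset.mem_Ico.2 ⟨Int.emod_nonneg _ hn.ne', Int.emod_lt_of_pos _ hn⟩)
  let S : Set (ℤ × ℤ) := Set.Icc (0, 0) (n, n + 2 * M)
  have : Finite {p : AffineInversion f // p.1 ∈ S} := by
    have : Finite S := (Set.finite_Icc _ _).to_subtype
    refine Finite.of_injective (fun p => (⟨p.1.1, p.2⟩ : S)) fun p q h => ?_
    exact Subtype.ext (Subtype.ext (congrArg (fun x : S => x.1) h))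
  refine Finite.of_surjective
    (fun p : {p : AffineInversion f // p.1 ∈ S} => (Quotient.mk _ p.1)) fun q => ?_
  obtain ⟨⟨⟨a, b⟩, hab, hf⟩, rfl⟩ := Quotient.exists_rep q
  simp only at hab hf
  have h0 := Int.emod_add_mul_ediv a n
  have h1 := Int.emod_nonneg a hn.ne'
  have h2 := Int.emod_lt_of_pos a hn
  have h3 := abs_le.1 (hM a)
  have h4 := abs_le.1 (hM b)
  refine ⟨⟨⟨(a + -(a / n) * n, b + -(a / n) * n), ?_, ?_⟩, ?_⟩, Quotient.sound ⟨a / n, ?_, ?_⟩⟩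
  · simp only; linarith
  · simp only [affinePerm_add_mul]; linarith
  · simp only [S, Set.mem_Icc, Prod.mk_le_mk]
    refine ⟨⟨?_, ?_⟩, ?_, ?_⟩ <;> linarith
  · simp only; ring
  · simp only; ring

/-- Multiplication by a reflection that puts two values out of order adds at least one class of
inversions. -/
theorem affineLength_lt_of_transposition [NeZero n] {f : AffinePerm n} {i j : ℤ} (hij : i < j)
    {t : AffinePerm n} (ht : IsAffineTransposition i j t) (hf : f.1 i < f.1 j) :
    affineLength f < affineLength (f * t) := by
  let F : Quotient (affineInversionSetoid f) → Quotient (affineInversionSetoid (f * t)) :=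
    Quotient.map (swapInversion hij ht hf) (by
      rintro ⟨p, hp⟩ ⟨q, hq⟩ ⟨r, h1, h2⟩
      simp only at h1 h2
      refine ⟨r, ?_⟩
      simp only [swapInversion, affineSwapPair]
      rw [h1, h2, affinePerm_add_mul, affinePerm_add_mul]
      simp only [add_lt_add_iff_right]
      split_ifs
      · exact ⟨rfl, rfl⟩
      · exact ⟨h1, h2⟩)
  have hF : Function.Injective F := by
    intro p q
    induction p using Quotient.inductionOn
    induction q using Quotient.inductionOn
    rename_i p q
    intro h
    obtain ⟨r, h1, h2⟩ := Quotient.exact h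
    exact Quotient.sound ⟨r, affineSwapPair_injective_mod ht p.2.1 q.2.1 h1 h2⟩
  have := finite_affineInversion_quotient f
  have := finite_affineInversion_quotient (f * t)
  have hti : t.1 i = j := by simpa using ht.2.1 0
  have htj : t.1 j = i := by simpa using ht.2.2.1 0
  -- the class of `(i, j)` is not in the image
  have hsurj : ¬ Function.Surjective F := by
    intro hs
    obtain ⟨p, hp⟩ := hs (Quotient.mk _ ⟨(i, j), hij, by simpa [hti, htj] using hf⟩)
    induction p using Quotient.inductionOn
    rename_i p
    obtain ⟨r, h1, h2⟩ := Quotient.exact hp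
    obtain ⟨⟨a, b⟩, h3, h4⟩ := p
    have e1 := ht.apply_self a
    have e2 := ht.apply_self b
    simp only [swapInversion, affineSwapPair] at h1 h2 h3 h4
    split_ifs at h1 h2 with c
    · simp only at h1 h2
      have e3 : t.1 a = i + -r * n := by linarith
      have e4 : t.1 b = j + -r * n := by linarith
      rw [e3, affinePerm_add_mul, hti] at e1
      rw [e4, affinePerm_add_mul, htj] at e2
      omega
    · have e3 : a = i + -r * n := by linarith
      have e4 : b = j + -r * n := by linarith
      rw [e3, e4, affinePerm_add_mul, affinePerm_add_mul] at h4
      omega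
  unfold affineLength
  refine lt_of_le_of_ne (Nat.card_le_card_of_injective F hF) fun e => hsurj ?_
  exact ((Nat.bijective_iff_injective_and_card F).2 ⟨hF, e⟩).2

theorem SwapUp.step [NeZero n] {f g : AffinePerm n} {i j : ℤ} (h : SwapUp f g i j) :
    AffineBruhatStep f g := by
  obtain ⟨hij, hmod, hf, hi, hj, hm⟩ := h
  have hinv : ∀ m, (f⁻¹).1 (f.1 m) = m := f.1.symm_apply_apply
  have ht : IsAffineTransposition i j (f⁻¹ * g) := by
    refine ⟨hmod, fun r => ?_, fun r => ?_, fun m h1 h2 => ?_⟩ <;>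
      rw [Subgroup.coe_mul, Equiv.Perm.mul_apply]
    · rw [affinePerm_add_mul, affinePerm_add_mul, hi, hinv]
    · rw [affinePerm_add_mul, affinePerm_add_mul, hj, hinv]
    · rw [hm m h1 h2, hinv]
  have hg : g = f * (f⁻¹ * g) := by group
  exact ⟨i, j, _, ht, hg, hg ▸ affineLength_lt_of_transposition hij ht hf⟩

theorem IsAffineTransposition.symm {i j : ℤ} {t : AffinePerm n}
    (ht : IsAffineTransposition i j t) : IsAffineTransposition j i t :=
  ⟨fun h => ht.1 h.symm, ht.2.2.1, ht.2.1, fun m h1 h2 => ht.2.2.2 m h2 h1⟩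

theorem affineBruhatStep_iff [NeZero n] {f g : AffinePerm n} :
    AffineBruhatStep f g ↔ ∃ i j, SwapUp f g i j := by
  refine ⟨?_, fun ⟨i, j, h⟩ => h.step⟩
  rintro ⟨i, j, t, ht, rfl, hl⟩
  wlog hij : i < j generalizing i j
  · refine this j i ht.symm (lt_of_le_of_ne (not_lt.1 hij) fun e => ?_)
    exact ht.1 (e ▸ Int.ModEq.refl _)
  have hti : t.1 i = j := by simpa using ht.2.1 0
  have htj : t.1 j = i := by simpa using ht.2.2.1 0
  refine ⟨i, j, hij, ht.1, ?_, by simp [hti], by simp [htj],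
    fun m h1 h2 => by simp [ht.2.2.2 m h1 h2]⟩
  by_contra hf
  have hne : f.1 i ≠ f.1 j := fun e => hij.ne (f.1.injective e)
  have htt : t * t = 1 := affinePerm_ext fun m => by simpa using ht.apply_self m
  have := affineLength_lt_of_transposition (f := f * t) hij ht (by
    simp only [Subgroup.coe_mul, Equiv.Perm.mul_apply, hti, htj]
    omega)
  rw [mul_assoc, htt, mul_one] at this
  exact hl.asymm this

theorem shift_zpow_apply (m i : ℤ) : (shift n ^ m).1 i = i + m := by
  induction m using Int.induction_on generalizing i with
  | zero => simp
  | succ m ih =>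
    rw [zpow_add_one, Subgroup.coe_mul, Equiv.Perm.mul_apply, ih]
    change i + 1 + (m : ℤ) = _
    ring
  | pred m ih =>
    rw [zpow_sub_one, Subgroup.coe_mul, Equiv.Perm.mul_apply, ih]
    change i + -1 + -(m : ℤ) = _
    ring

theorem SwapUp.mul_shift {f g : AffinePerm n} {i j : ℤ} (h : SwapUp f g i j) (m : ℤ) :
    SwapUp (f * shift n ^ m) (g * shift n ^ m) (i - m) (j - m) := by
  obtain ⟨hij, hmod, hf, hi, hj, hm⟩ := h
  have hsub : ∀ x y : ℤ, ¬ x ≡ y - m [ZMOD n] → ¬ x + m ≡ y [ZMOD n] := fun x y h1 h2 =>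
    h1 (by simpa using h2.sub_right m)
  refine ⟨by linarith, fun h => hmod (by simpa using h.add_right m), ?_, ?_, ?_,
    fun x h1 h2 => ?_⟩ <;>
    simp only [Subgroup.coe_mul, Equiv.Perm.mul_apply, shift_zpow_apply, sub_add_cancel]
  · exact hf
  · exact hi
  · exact hj
  · exact hm _ (hsub x i h1) (hsub x j h2)

theorem AffineBruhatLE.mul_shift [NeZero n] {f g : AffinePerm n} (h : AffineBruhatLE f g)
    (m : ℤ) : AffineBruhatLE (f * shift n ^ m) (g * shift n ^ m) := by
  refine Relation.ReflTransGen.lift (fun f => f * shift n ^ m) (fun f g h => ?_) _ _ h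
  obtain ⟨i, j, h⟩ := affineBruhatStep_iff.1 h
  exact (h.mul_shift m).step

theorem affineBruhatLEOn_iff [NeZero n] {k : ℤ} {f g : AffinePerm n} :
    AffineBruhatLEOn k f g ↔ AffineBruhatLE f g := by
  refine ⟨fun h => ?_, fun h => h.mul_shift _⟩
  have := AffineBruhatLE.mul_shift h k
  rwa [mul_assoc, mul_assoc, zpow_neg, inv_mul_cancel, mul_one, mul_one] at this

/-- The bound `i ≤ f i ≤ i + n` of `Bound k n`, without the condition on the ball number. -/
def IsBounded (f : AffinePerm n) : Prop := ∀ i : ℤ, i ≤ f.1 i ∧ f.1 i ≤ i + n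

/-- Bounded affine permutations form a lower set: in the sorted order of `i < j` and
`f i < f j`, the bounds at `i` and `j` can only become easier. -/
theorem SwapUp.isBounded {f g : AffinePerm n} {i j : ℤ} (h : SwapUp f g i j) (hg : IsBounded g) :
    IsBounded f := by
  obtain ⟨hij, hmod, hf, hi, hj, hm⟩ := h
  have h1 := hg i
  have h2 := hg j
  intro m
  by_cases hmi : m ≡ i [ZMOD n]
  · obtain ⟨r, rfl⟩ := exists_add_mul_of_modEq hmi
    rw [affinePerm_add_mul]
    constructor <;> linarith
  by_cases hmj : m ≡ j [ZMOD n]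
  · obtain ⟨r, rfl⟩ := exists_add_mul_of_modEq hmj
    rw [affinePerm_add_mul]
    constructor <;> linarith
  · rw [← hm m hmi hmj]; exact hg m

end Affine

/-! ### Values of `f_{u,w}` and the bijection with bounded affine permutations -/

section Coordinates
variable {n : ℕ}

theorem omega_eq_zero_or_one (k : ℕ) (a : Fin n) :
    ((a : ℕ) < k ∧ omega k a = 1) ∨ (k ≤ (a : ℕ) ∧ omega k a = 0) := by
  unfold omega
  split_ifs with h
  · exact Or.inl ⟨h, rfl⟩
  · exact Or.inr ⟨not_lt.1 h, rfl⟩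

theorem omega_eq_iff {k : ℕ} {a b : Fin n} : omega k a = omega k b ↔ SameBlock k a b := by
  unfold omega SameBlock
  split_ifs <;> simp_all [not_lt.2]

theorem ballNumber_eq (f : AffinePerm n) (w : Equiv.Perm (Fin n)) :
    ballNumber f = 1 / (n : ℚ) *
      ((∑ a, (f.1 ((w a : ℤ) + 1) - ((w a : ℤ) + 1)) : ℤ) : ℚ) := by
  unfold ballNumber
  congr 1
  rw [Equiv.sum_comp w (fun a : Fin n => f.1 ((a : ℤ) + 1) - ((a : ℤ) + 1))]
  push_cast
  symm
  refine Finset.sum_bij (fun (a : Fin n) _ => (a : ℤ) + 1) (fun a _ => ?_) (fun a _ b _ h => ?_)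
    (fun m hm => ?_) (fun a _ => by push_cast; rfl)
  · have := a.2
    rw [Finset.mem_Icc]; omega
  · exact Fin.ext (by omega)
  · rw [Finset.mem_Icc] at hm
    exact ⟨⟨(m - 1).toNat, by omega⟩, Finset.mem_univ _, by simp only; omega⟩

theorem sum_omega {k : ℕ} (hkn : k ≤ n) : ∑ a : Fin n, omega k a = k := by
  unfold omega
  rw [Finset.sum_ite, Finset.sum_const_zero, add_zero, Finset.sum_const, nsmul_eq_mul, mul_one,
    Fin.card_filter_val_lt, min_eq_right hkn]

end Coordinates

section Pairs
variable {n : ℕ} [NeZero n]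

/-- Integers are written as `a + 1 + n * r` with `a : Fin n`, where `a + 1` is the residue in
`{1, …, n}`. -/
theorem coord_inj {a b : Fin n} {r s : ℤ} (h : (a : ℤ) + 1 + n * r = (b : ℤ) + 1 + n * s) :
    a = b ∧ r = s := by
  have e := congrArg (residue n) h
  rw [residue_add_mul, residue_add_mul, residue_coe, residue_coe] at e
  subst e
  have hn : (n : ℤ) ≠ 0 := by exact_mod_cast NeZero.ne n
  exact ⟨rfl, mul_left_cancel₀ hn (by linarith)⟩

theorem exists_coord (i : ℤ) : ∃ (a : Fin n) (r : ℤ), i = (a : ℤ) + 1 + n * r := by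
  refine ⟨residue n i, (i - 1) / n, ?_⟩
  have := Int.emod_add_mul_ediv (i - 1) n
  rw [residue_val]
  linarith

theorem exists_coord_perm (w : Equiv.Perm (Fin n)) (i : ℤ) :
    ∃ (a : Fin n) (r : ℤ), i = (w a : ℤ) + 1 + n * r := by
  obtain ⟨a, r, h⟩ := exists_coord (n := n) i
  exact ⟨w⁻¹ a, r, by rw [h]; simp⟩

theorem eq_of_coord_modEq {a b : Fin n} {r s : ℤ}
    (h : (a : ℤ) + 1 + n * r ≡ (b : ℤ) + 1 + n * s [ZMOD n]) : a = b := by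
  obtain ⟨q, hq⟩ := exists_add_mul_of_modEq h
  exact (coord_inj (s := s + q) (by rw [hq]; ring)).1

theorem extend_apply (u : Equiv.Perm (Fin n)) (a : Fin n) (r : ℤ) :
    (extend u).1 ((a : ℤ) + 1 + n * r) = (u a : ℤ) + 1 + n * r := by
  have hn : (n : ℤ) ≠ 0 := by exact_mod_cast NeZero.ne n
  change extendFun u _ = _
  rw [extendFun, residue_add_mul, residue_coe,
    show (a : ℤ) + 1 + n * r - 1 = a + n * r by ring, Int.add_mul_ediv_left _ _ hn,
    Int.ediv_eq_zero_of_lt (by positivity) (by exact_mod_cast a.2), zero_add]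

theorem translation_apply (μ : Fin n → ℤ) (a : Fin n) (r : ℤ) :
    (translation μ).1 ((a : ℤ) + 1 + n * r) = (a : ℤ) + 1 + n * (r + μ a) := by
  change n * μ (residue n _) + _ = _
  rw [residue_add_mul, residue_coe]
  ring

/-- The values of `f_{u,w}`, for arguments written in terms of `w`. -/
theorem pairAffine_apply (k : ℕ) (u w : Equiv.Perm (Fin n)) (a : Fin n) (r : ℤ) :
    (pairAffine k u w).1 ((w a : ℤ) + 1 + n * r) = (u a : ℤ) + 1 + n * (r + omega k a) := by
  have h : ((extend w)⁻¹).1 ((w a : ℤ) + 1 + n * r) = (a : ℤ) + 1 + n * r := by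
    rw [← extend_apply]
    exact (extend w).1.symm_apply_apply _
  rw [pairAffine, Subgroup.coe_mul, Subgroup.coe_mul, Equiv.Perm.mul_apply, Equiv.Perm.mul_apply,
    h, translation_apply, extend_apply]

theorem eq_pairAffine {k : ℕ} {u w : Equiv.Perm (Fin n)} {g : AffinePerm n}
    (h : ∀ a, g.1 ((w a : ℤ) + 1) = (u a : ℤ) + 1 + n * omega k a) : g = pairAffine k u w := by
  refine affinePerm_ext fun m => ?_
  obtain ⟨a, r, rfl⟩ := exists_coord_perm w m
  rw [pairAffine_apply, mul_comm, affinePerm_add_mul, h]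
  ring

theorem pairAffine_mul_of_inParabolic {k : ℕ} (u w : Equiv.Perm (Fin n))
    {z : Equiv.Perm (Fin n)} (hz : InParabolic k z) :
    pairAffine k (u * z) (w * z) = pairAffine k u w := by
  refine (eq_pairAffine fun a => ?_).symm
  have h := pairAffine_apply k u w (z a) 0
  rw [mul_zero, add_zero, zero_add, omega_eq_iff.2 (hz a)] at h
  exact h

/-- For `a` in the first block the nontrivial bound is `f (w a) ≤ w a + n`, in the second block it
is `w b ≤ f (w b)`. -/
theorem isBounded_pairAffine_iff {k : ℕ} {u w : Equiv.Perm (Fin n)} :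
    IsBounded (pairAffine k u w) ↔ MovesUpDown k u w := by
  have hlt : ∀ a : Fin n, ((a : ℕ) : ℤ) < n := fun a => by exact_mod_cast a.2
  constructor
  · intro h
    refine ⟨fun a ha => ?_, fun a ha => ?_⟩ <;>
    · have h1 := h ((w a : ℤ) + 1 + n * 0)
      rw [pairAffine_apply] at h1
      rw [Fin.le_def]
      rcases omega_eq_zero_or_one k a with ⟨h2, h3⟩ | ⟨h2, h3⟩ <;> rw [h3] at h1 <;> omega
  · intro h m
    obtain ⟨a, r, rfl⟩ := exists_coord_perm w m
    have h1 := hlt (u a)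
    have h2 := hlt (w a)
    rw [pairAffine_apply, mul_add]
    rcases omega_eq_zero_or_one k a with ⟨h2, h3⟩ | ⟨h2, h3⟩ <;> rw [h3]
    · have := h.1 a h2
      rw [Fin.le_def] at this
      constructor <;> omega
    · have := h.2 a h2
      rw [Fin.le_def] at this
      constructor <;> omega

theorem ballNumber_pairAffine {k : ℕ} (hkn : k ≤ n) (u w : Equiv.Perm (Fin n)) :
    ballNumber (pairAffine k u w) = k := by
  have hn : (n : ℚ) ≠ 0 := by exact_mod_cast NeZero.ne n
  have h : ∀ a, (pairAffine k u w).1 ((w a : ℤ) + 1) = (u a : ℤ) + 1 + n * omega k a := fun a => by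
    simpa using pairAffine_apply k u w a 0
  rw [ballNumber_eq _ w]
  simp only [h]
  rw [Finset.sum_sub_distrib, Finset.sum_add_distrib, ← Finset.mul_sum, sum_omega hkn,
    Equiv.sum_comp u (fun a : Fin n => (a : ℤ) + 1),
    Equiv.sum_comp w (fun a : Fin n => (a : ℤ) + 1)]
  push_cast
  field_simp
  ring

/-- Every bounded affine permutation is `f_{u,w}` for some `k`-Bruhat interval. -/
theorem Bound.exists_pairAffine_eq {k : ℕ} (hkn : k ≤ n) (f : Bound k n) :
    ∃ I : KBruhatInterval k n, pairAffine k I.u I.w = f.f := by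
  have hn : (n : ℤ) ≠ 0 := by exact_mod_cast NeZero.ne n
  choose π e he using fun a : Fin n => exists_coord (n := n) (f.f.1 ((a : ℤ) + 1))
  -- `e a = 1` marks the arguments with `f (a + 1) > n`
  have he01 : ∀ a, e a = 0 ∨ e a = 1 := by
    intro a
    have h := f.bounded ((a : ℤ) + 1)
    rw [he] at h
    have h1 := a.2
    have h2 := (π a).2
    have h3 : -1 < e a := by
      by_contra hlt
      have : (n : ℤ) * e a ≤ n * (-1) := mul_le_mul_of_nonneg_left (not_lt.1 hlt) (by positivity)
      omega
    have h4 : e a < 2 := by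
      by_contra hlt
      have : (n : ℤ) * 2 ≤ n * e a := mul_le_mul_of_nonneg_left (not_lt.1 hlt) (by positivity)
      omega
    omega
  have hπ : Function.Injective π := by
    intro a b hab
    have h : f.f.1 ((a : ℤ) + 1 + -e a * n) = f.f.1 ((b : ℤ) + 1 + -e b * n) := by
      rw [affinePerm_add_mul, affinePerm_add_mul, he, he, hab]; ring
    have h' := f.f.1.injective h
    exact (coord_inj (r := - e a) (s := - e b) (by linarith)).1
  let p : Equiv.Perm (Fin n) := Equiv.ofBijective π (Finite.injective_iff_bijective.1 hπ)
  have hp : ∀ a : Fin n, f.f.1 ((a : ℤ) + 1) = (p a : ℤ) + 1 + n * e a := he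
  have hsum : ∑ a, e a = k := by
    have hb := f.ball
    rw [ballNumber_eq _ 1] at hb
    simp only [Equiv.Perm.one_apply, hp] at hb
    rw [Finset.sum_sub_distrib, Finset.sum_add_distrib, ← Finset.mul_sum,
      Equiv.sum_comp p (fun a : Fin n => (a : ℤ) + 1)] at hb
    have hn' : (n : ℚ) ≠ 0 := by exact_mod_cast NeZero.ne n
    rw [add_sub_cancel_left] at hb
    push_cast at hb
    rw [← mul_assoc, one_div, inv_mul_cancel₀ hn', one_mul] at hb
    exact_mod_cast hb
  have hcard : Fintype.card {a : Fin n // (a : ℕ) < k} = Fintype.card {a : Fin n // e a = 1} := by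
    have h1 : ∑ a, e a = ((Finset.univ.filter fun a => e a = 1).card : ℤ) := by
      rw [Finset.card_filter]
      push_cast
      refine Finset.sum_congr rfl fun a _ => ?_
      rcases he01 a with h | h <;> simp [h]
    rw [Fintype.card_subtype, Fintype.card_subtype, Fin.card_filter_val_lt, min_eq_right hkn]
    exact_mod_cast hsum.symm.trans h1
  -- `w` sends the first block onto the set where `e = 1`
  let E := Fintype.equivOfCardEq hcard
  let w : Equiv.Perm (Fin n) := E.extendSubtype
  have hw : ∀ a, e (w a) = omega k a := by
    intro a
    rcases omega_eq_zero_or_one k a with ⟨h1, h2⟩ | ⟨h1, h2⟩ <;> rw [h2]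
    · exact E.extendSubtype_mem a h1
    · exact (he01 _).resolve_right (E.extendSubtype_not_mem a (not_lt.2 h1))
  have hf : f.f = pairAffine k (p * w) w := eq_pairAffine fun a => by
    rw [hp, hw]; rfl
  have hbd : IsBounded f.f := f.bounded
  rw [hf, isBounded_pairAffine_iff] at hbd
  obtain ⟨z, hz, hle, -⟩ := hbd.exists_kBruhatLE
  exact ⟨⟨_, _, hle⟩, (pairAffine_mul_of_inParabolic _ _ hz).trans hf.symm⟩

theorem pairAffine_eq_of_mk_eq {k : ℕ} {I J : KBruhatInterval k n} (h : Q.mk I = Q.mk J) :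
    pairAffine k I.u I.w = pairAffine k J.u J.w := by
  have h' : Relation.EqvGen KBruhatInterval.Rel I J := Quotient.exact h
  clear h
  induction h' with
  | rel I J h =>
    obtain ⟨z, hz, h1, -, h2, -⟩ := h
    rw [h1, h2, pairAffine_mul_of_inParabolic _ _ hz]
  | refl => rfl
  | symm I J _ ih => exact ih.symm
  | trans I J K _ _ ih ih' => exact ih.trans ih'

/-- The affine permutation determines the class: a representative with Grassmannian upper end
can be read off from it. -/
theorem mk_eq_of_pairAffine_eq {k : ℕ} {I J : KBruhatInterval k n}
    (h : pairAffine k I.u I.w = pairAffine k J.u J.w) : Q.mk I = Q.mk J := by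
  obtain ⟨⟨u, w, hI⟩, hIe, hg⟩ := exists_grassmannian I
  obtain ⟨⟨u', w', hJ⟩, hJe, hg'⟩ := exists_grassmannian J
  rw [← pairAffine_eq_of_mk_eq hIe, ← pairAffine_eq_of_mk_eq hJe] at h
  rw [← hIe, ← hJe]
  simp only at h hg hg'
  have hval : ∀ a, u a = u' ((w'⁻¹ * w) a) ∧ omega k a = omega k ((w'⁻¹ * w) a) := by
    intro a
    have h1 := pairAffine_apply k u w a 0
    have h2 := pairAffine_apply k u' w' ((w'⁻¹ * w) a) 0
    have e : w' ((w'⁻¹ * w) a) = w a := w'.apply_symm_apply _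
    rw [e, ← h, h1] at h2
    have := coord_inj h2
    exact ⟨this.1, by simpa using this.2⟩
  have hw : w = w' := hg.eq_of_inParabolic hg' fun a => (omega_eq_iff.1 (hval a).2).symm
  subst hw
  have hu : u = u' := Equiv.ext fun a => by simpa using (hval a).1
  subst hu
  rfl

end Pairs

/-! ### Comparison of the two orders -/

section Order
variable {n : ℕ} [NeZero n]

theorem pairAffine_apply_zero (k : ℕ) (u w : Equiv.Perm (Fin n)) (a : Fin n) :
    (pairAffine k u w).1 ((w a : ℤ) + 1) = (u a : ℤ) + 1 + n * omega k a := by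
  simpa using pairAffine_apply k u w a 0

/-- If `w` is Grassmannian, a Bruhat step up in `u` is a Bruhat step up in `f_{u,w}`. -/
theorem Grassmannian.swapUp {k : ℕ} {u w : Equiv.Perm (Fin n)} (hw : Grassmannian k w)
    {a b : Fin n} (hab : a < b) (hu : u a < u b) :
    ∃ i j, SwapUp (pairAffine k u w) (pairAffine k (u * Equiv.swap a b) w) i j := by
  have hua : ((u a : ℕ) : ℤ) < u b := by exact_mod_cast hu
  have hwab := (w a).2
  have hother : ∀ m : ℤ, ¬ m ≡ (w a : ℤ) + 1 + n * 0 [ZMOD n] →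
      ¬ m ≡ (w b : ℤ) + 1 + n * (omega k a - omega k b) [ZMOD n] →
      (pairAffine k (u * Equiv.swap a b) w).1 m = (pairAffine k u w).1 m := by
    intro m h1 h2
    obtain ⟨c, r, rfl⟩ := exists_coord_perm w m
    have hca : c ≠ a := fun e => h1 (by
      rw [e]; exact (Int.modEq_iff_dvd.2 ⟨-r, by ring⟩))
    have hcb : c ≠ b := fun e => h2 (by
      rw [e]; exact (Int.modEq_iff_dvd.2 ⟨omega k a - omega k b - r, by ring⟩))
    rw [pairAffine_apply, pairAffine_apply, Equiv.Perm.mul_apply,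
      Equiv.swap_apply_of_ne_of_ne hca hcb]
  refine ⟨_, _, ?_, fun h => hab.ne (w.injective (eq_of_coord_modEq h)), ?_, ?_, ?_, hother⟩
  · -- across the blocks the swap happens between the positions `w a` and `w b + n`
    by_cases hb : SameBlock k a b
    · have h1 := hw a b hab hb
      rw [omega_eq_iff.2 hb, Fin.lt_def] at *
      simp only [sub_self, mul_zero]
      omega
    · have hab' : (a : ℕ) < b := hab
      unfold SameBlock at hb
      rcases omega_eq_zero_or_one k a with ⟨h1, h2⟩ | ⟨h1, h2⟩ <;>
      rcases omega_eq_zero_or_one k b with ⟨h3, h4⟩ | ⟨h3, h4⟩ <;>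
      rw [h2, h4] <;> omega
  · rw [pairAffine_apply, pairAffine_apply]
    linarith
  · rw [pairAffine_apply, pairAffine_apply, Equiv.Perm.mul_apply, Equiv.swap_apply_left]
    ring
  · rw [pairAffine_apply, pairAffine_apply, Equiv.Perm.mul_apply, Equiv.swap_apply_right]
    ring

/-- A `k`-Bruhat cover in the upper end is a Bruhat step down in `f_{u,w}`, whatever `u` is. -/
theorem swapUp_of_lt {k : ℕ} (u : Equiv.Perm (Fin n)) {v : Equiv.Perm (Fin n)} {a b : Fin n}
    (ha : (a : ℕ) < k) (hb : k ≤ (b : ℕ)) (hv : v a < v b) :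
    ∃ i j, SwapUp (pairAffine k u (v * Equiv.swap a b)) (pairAffine k u v) i j := by
  have hua := (u a).2
  have hub := (u b).2
  have hva : ((v a : ℕ) : ℤ) < v b := by exact_mod_cast hv
  have hab : a ≠ b := fun e => by subst e; omega
  have hωa : omega k a = 1 := if_pos ha
  have hωb : omega k b = 0 := if_neg (not_lt.2 hb)
  have ea : (pairAffine k u (v * Equiv.swap a b)).1 ((v a : ℤ) + 1) = u b + 1 + n * omega k b := by
    simpa using pairAffine_apply_zero k u (v * Equiv.swap a b) b
  have eb : (pairAffine k u (v * Equiv.swap a b)).1 ((v b : ℤ) + 1) = u a + 1 + n * omega k a := by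
    simpa using pairAffine_apply_zero k u (v * Equiv.swap a b) a
  refine ⟨(v a : ℤ) + 1, (v b : ℤ) + 1, by linarith, fun h => ?_, ?_, ?_, ?_, fun m h1 h2 => ?_⟩
  · exact hab (v.injective (eq_of_coord_modEq (r := 0) (s := 0) (by simpa using h)))
  · rw [ea, eb, hωa, hωb]; omega
  · rw [eb, pairAffine_apply_zero]
  · rw [ea, pairAffine_apply_zero]
  · obtain ⟨c, r, rfl⟩ := exists_coord_perm v m
    have hca : c ≠ a := fun e => h1 (by
      rw [e]; exact (Int.modEq_iff_dvd.2 ⟨-r, by ring⟩))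
    have hcb : c ≠ b := fun e => h2 (by
      rw [e]; exact (Int.modEq_iff_dvd.2 ⟨-r, by ring⟩))
    have h := pairAffine_apply k u (v * Equiv.swap a b) c r
    rw [Equiv.Perm.mul_apply, Equiv.swap_apply_of_ne_of_ne hca hcb] at h
    rw [pairAffine_apply, h]

theorem Grassmannian.affineBruhatLE {k : ℕ} {u u' w : Equiv.Perm (Fin n)}
    (hw : Grassmannian k w) (h : BruhatLE u u') :
    AffineBruhatLE (pairAffine k u w) (pairAffine k u' w) := by
  refine Relation.ReflTransGen.lift (fun u => pairAffine k u w) (fun u u' h => ?_) _ _ h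
  obtain ⟨a, b, hab, hu, rfl⟩ := bruhatStep_iff.1 h
  exact affineBruhatStep_iff.2 (hw.swapUp hab hu)

theorem KBruhatLE.affineBruhatLE {k : ℕ} {w w' : Equiv.Perm (Fin n)} (h : KBruhatLE k w w')
    (u : Equiv.Perm (Fin n)) :
    AffineBruhatLE (pairAffine k u w') (pairAffine k u w) := by
  induction h with
  | refl => exact Relation.ReflTransGen.refl
  | tail _ hs ih =>
    obtain ⟨a, b, ha, hb, hv, rfl, -⟩ := hs.exists_swap
    exact Relation.ReflTransGen.head (affineBruhatStep_iff.2 (swapUp_of_lt u ha hb hv)) ih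

/-- Larger Bruhat intervals have smaller affine permutations. -/
theorem affineBruhatLE_of_subset {k : ℕ} {I' I : KBruhatInterval k n}
    (h : bruhatInterval I.u I.w ⊆ bruhatInterval I'.u I'.w) :
    AffineBruhatLE (pairAffine k I'.u I'.w) (pairAffine k I.u I.w) := by
  obtain ⟨h1, h2⟩ := (bruhatInterval_subset_iff I.le.bruhatLE).1 h
  obtain ⟨J', J, hJ', hJ, hg, h3, h4⟩ := exists_grassmannian_of_le I' I h1 h2
  rw [← pairAffine_eq_of_mk_eq hJ', ← pairAffine_eq_of_mk_eq hJ]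
  exact (hg.affineBruhatLE h3).trans ((h4.kBruhatLE hg).affineBruhatLE J.u)

/-- A Bruhat step up from `f_{u,w}` to a bounded affine permutation is a Bruhat step up in `u` or
a Bruhat step down in `w`. -/
theorem SwapUp.exists_pair {k : ℕ} {u w : Equiv.Perm (Fin n)} {g : AffinePerm n} {i j : ℤ}
    (h : SwapUp (pairAffine k u w) g i j) (hg : IsBounded g) :
    ∃ u' w', BruhatLE u u' ∧ BruhatLE w' w ∧ g = pairAffine k u' w' := by
  obtain ⟨hij, hmod, hf, hi, hj, hm⟩ := h
  obtain ⟨a, r, rfl⟩ := exists_coord_perm w i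
  obtain ⟨b, s, rfl⟩ := exists_coord_perm w j
  have hab : a ≠ b := fun e => hmod (by
    rw [e]; exact (Int.modEq_iff_dvd.2 ⟨s - r, by ring⟩))
  have hbi := (hg ((w a : ℤ) + 1 + n * r)).2
  have hbj := (hg ((w b : ℤ) + 1 + n * s)).1
  have ga : g.1 ((w a : ℤ) + 1) = (u b : ℤ) + 1 + n * (omega k b + (s - r)) := by
    rw [show (w a : ℤ) + 1 = (w a : ℤ) + 1 + n * r + -r * n by ring, affinePerm_add_mul, hi,
      pairAffine_apply]
    ring
  have gb : g.1 ((w b : ℤ) + 1) = (u a : ℤ) + 1 + n * (omega k a - (s - r)) := by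
    rw [show (w b : ℤ) + 1 = (w b : ℤ) + 1 + n * s + -s * n by ring, affinePerm_add_mul, hj,
      pairAffine_apply]
    ring
  have gc : ∀ c, c ≠ a → c ≠ b → g.1 ((w c : ℤ) + 1) = (u c : ℤ) + 1 + n * omega k c := by
    intro c hca hcb
    rw [hm, pairAffine_apply_zero]
    · exact fun h => hca (w.injective (eq_of_coord_modEq (r := 0) (by simpa only [mul_zero, add_zero] using h)))
    · exact fun h => hcb (w.injective (eq_of_coord_modEq (r := 0) (by simpa only [mul_zero, add_zero] using h)))
  rw [hi, pairAffine_apply] at hbi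
  rw [hj, pairAffine_apply] at hbj
  rw [pairAffine_apply, pairAffine_apply] at hf
  obtain ⟨m, hs⟩ : ∃ m, s = r + m := ⟨s - r, by ring⟩
  subst hs
  rw [add_sub_cancel_left] at ga gb
  have h1 := (w a).2
  have h2 := (w b).2
  have h3 := (u a).2
  have h4 := (u b).2
  -- the two positions are less than `n` apart
  have hm0 : -1 < m := by
    by_contra hlt
    have : (n : ℤ) * m ≤ n * (-1) := mul_le_mul_of_nonneg_left (not_lt.1 hlt) (by positivity)
    rw [mul_add] at hij
    omega
  have hm1 : m < 2 := by
    by_contra hlt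
    have : (n : ℤ) * 2 ≤ n * m := mul_le_mul_of_nonneg_left (not_lt.1 hlt) (by positivity)
    simp only [mul_add] at *
    omega
  have hswapU : omega k b + m = omega k a → a < b → u a < u b → ∃ u' w', BruhatLE u u' ∧
      BruhatLE w' w ∧ g = pairAffine k u' w' := by
    intro hω hlt hu
    refine ⟨u * Equiv.swap a b, w, bruhatLE_swap hlt hu, Relation.ReflTransGen.refl,
      eq_pairAffine fun c => ?_⟩
    rcases swap_trichotomy a b c with ⟨rfl, e⟩ | ⟨rfl, e⟩ | ⟨hca, hcb, e⟩ <;>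
      rw [Equiv.Perm.mul_apply, e]
    · rw [ga, hω]
    · rw [gb, ← hω]; ring
    · exact gc c hca hcb
  have hswapW : m = 0 → b < a → w a < w b → ∃ u' w', BruhatLE u u' ∧
      BruhatLE w' w ∧ g = pairAffine k u' w' := by
    intro hm' hlt hw
    refine ⟨u, w * Equiv.swap b a, Relation.ReflTransGen.refl, swap_bruhatLE hlt hw,
      eq_pairAffine fun c => ?_⟩
    rcases swap_trichotomy b a c with ⟨rfl, e⟩ | ⟨rfl, e⟩ | ⟨hca, hcb, e⟩ <;>
      rw [Equiv.Perm.mul_apply, e]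
    · rw [ga, hm', add_zero]
    · rw [gb, hm', sub_zero]
    · exact gc c hcb hca
  simp only [Fin.lt_def] at hswapU hswapW
  have hab' : (a : ℕ) ≠ b := fun e => hab (Fin.ext e)
  obtain rfl | rfl : m = 0 ∨ m = 1 := by omega
  · rcases lt_or_gt_of_ne hab' with hlt | hlt
    · rcases omega_eq_zero_or_one k a with ⟨h5, h6⟩ | ⟨h5, h6⟩ <;>
      rcases omega_eq_zero_or_one k b with ⟨h7, h8⟩ | ⟨h7, h8⟩ <;>
      simp only [h6, h8] at hf hbi hbj hswapU <;>
      simp only [mul_add] at hf hbi hbj hij <;>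
      first
      | exact hswapU rfl hlt (by omega)
      | (exfalso; omega)
    · exact hswapW rfl hlt (by simp only [mul_add] at hij; omega)
  · rcases omega_eq_zero_or_one k a with ⟨h5, h6⟩ | ⟨h5, h6⟩ <;>
    rcases omega_eq_zero_or_one k b with ⟨h7, h8⟩ | ⟨h7, h8⟩ <;>
    simp only [h6, h8] at hf hbi hbj hswapU <;>
    simp only [mul_add] at hf hbi hbj hij <;>
    first
    | exact hswapU rfl (by omega) (by omega)
    | (exfalso; omega)

theorem AffineBruhatLE.isBounded {f g : AffinePerm n} (h : AffineBruhatLE f g)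
    (hg : IsBounded g) : IsBounded f := by
  induction h using Relation.ReflTransGen.head_induction_on with
  | refl => exact hg
  | head hs _ ih =>
    obtain ⟨i, j, hs⟩ := affineBruhatStep_iff.1 hs
    exact hs.isBounded ih

/-- A bounded affine permutation above `f_{u,w}` comes from a `k`-Bruhat interval with ends
between `u` and `w` in Bruhat order. -/
theorem AffineBruhatLE.exists_kBruhatInterval {k : ℕ} {u w : Equiv.Perm (Fin n)}
    {g : AffinePerm n} (h : AffineBruhatLE (pairAffine k u w) g) (hg : IsBounded g) :
    ∃ I : KBruhatInterval k n, BruhatLE u I.u ∧ BruhatLE I.w w ∧ pairAffine k I.u I.w = g := by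
  obtain ⟨f, hf⟩ : ∃ f, f = pairAffine k u w := ⟨_, rfl⟩
  rw [← hf] at h
  induction h using Relation.ReflTransGen.head_induction_on generalizing u w with
  | refl =>
    obtain ⟨z, hz, hle, h1, h2⟩ := (isBounded_pairAffine_iff.1 (hf ▸ hg)).exists_kBruhatLE
    exact ⟨⟨_, _, hle⟩, h1, h2, (pairAffine_mul_of_inParabolic u w hz).trans hf.symm⟩
  | @head f f₁ hs hle ih =>
    subst hf
    obtain ⟨i, j, hs⟩ := affineBruhatStep_iff.1 hs
    obtain ⟨u₁, w₁, h1, h2, rfl⟩ := hs.exists_pair (AffineBruhatLE.isBounded hle hg)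
    obtain ⟨I, h3, h4, h5⟩ := ih rfl
    exact ⟨I, h1.trans h3, h4.trans h2, h5⟩

end Order

/-! ### The length formula -/

section Length
variable {n : ℕ}

instance (k : ℕ) (a b : Fin n) : Decidable (SameBlock k a b) :=
  inferInstanceAs (Decidable ((a : ℕ) < k ↔ (b : ℕ) < k))

/-- The pairs of positions that account for the inversions of `f_{u,w}`. -/
def lengthPairs (k : ℕ) (u w : Equiv.Perm (Fin n)) : Finset (Fin n × Fin n) :=
  Finset.univ.filter fun p => p.1 < p.2 ∧
    if SameBlock k p.1 p.2 then w p.1 < w p.2 ∧ u p.2 < u p.1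
    else w p.1 < w p.2 ∨ u p.2 < u p.1

theorem mem_lengthPairs {k : ℕ} {u w : Equiv.Perm (Fin n)} {a b : Fin n} :
    (a, b) ∈ lengthPairs k u w ↔ a < b ∧
      if SameBlock k a b then w a < w b ∧ u b < u a else w a < w b ∨ u b < u a := by
  simp [lengthPairs]

theorem card_crossing {k : ℕ} (hkn : k ≤ n) :
    (Finset.univ.filter fun p : Fin n × Fin n => p.1 < p.2 ∧ ¬ SameBlock k p.1 p.2).card =
      k * (n - k) := by
  have h : (Finset.univ.filter fun p : Fin n × Fin n => p.1 < p.2 ∧ ¬ SameBlock k p.1 p.2) =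
      (Finset.univ.filter fun a : Fin n => (a : ℕ) < k) ×ˢ
        (Finset.univ.filter fun a : Fin n => (a : ℕ) < k)ᶜ := by
    ext ⟨a, b⟩
    simp only [Finset.mem_filter, Finset.mem_univ, true_and, Finset.mem_product,
      Finset.mem_compl, SameBlock, Fin.lt_def]
    omega
  rw [h, Finset.card_product, Finset.card_compl, Fin.card_filter_val_lt, min_eq_right hkn,
    Fintype.card_fin]

/-- Within a block every inversion of `w` is one of `u`, and across the blocks every inversion of
`u` is one of `w`. -/
theorem KBruhatLE.card_lengthPairs {k : ℕ} (hkn : k ≤ n) {u w : Equiv.Perm (Fin n)}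
    (h : KBruhatLE k u w) :
    (lengthPairs k u w).card + permLength w = k * (n - k) + permLength u := by
  obtain ⟨h1, h2⟩ := kBruhatLE_iff.1 h
  rw [← card_crossing hkn]
  unfold lengthPairs permLength
  simp only [Finset.card_filter]
  rw [← Finset.sum_add_distrib, ← Finset.sum_add_distrib]
  refine Finset.sum_congr rfl fun p _ => ?_
  obtain ⟨a, b⟩ := p
  simp only
  by_cases hab : a < b
  swap
  · simp [hab]
  have hu : u a < u b ∨ u b < u a := lt_or_gt_of_ne fun e => hab.ne (u.injective e)
  have hw : w a < w b ∨ w b < w a := lt_or_gt_of_ne fun e => hab.ne (w.injective e)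
  by_cases hb : SameBlock k a b
  · have h3 := h2 a b hab hb
    simp only [hab, hb, if_true, true_and, not_true, if_false]
    rcases hu with hu | hu <;> rcases hw with hw | hw <;>
      simp only [hu, hw, hu.asymm, hw.asymm, and_true, and_false, if_true, if_false]
    exact absurd (h3 hu) hw.asymm
  · have h3 : w b < w a ∨ u a < u b := by
      have hab' : (a : ℕ) < b := hab
      have hb' := hb
      unfold SameBlock at hb'
      refine hw.symm.imp_right fun hw => ?_
      exact (h1.1 a (by omega)).trans_lt (hw.trans_le (h1.2 b (by omega)))
    simp only [hab, hb, if_true, true_and, not_false_iff, if_false]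
    rcases hu with hu | hu <;> rcases hw with hw | hw <;>
      simp only [hu, hw, hu.asymm, hw.asymm, or_self, true_or, or_true, if_true, if_false]
    exact absurd h3 (not_or.2 ⟨hw.asymm, hu.asymm⟩)

theorem KBruhatLE.affineLength_eq_card [NeZero n] {k : ℕ} {u w : Equiv.Perm (Fin n)}
    (h : KBruhatLE k u w) :
    affineLength (pairAffine k u w) = (lengthPairs k u w).card := by
  obtain ⟨h1, h2⟩ := kBruhatLE_iff.1 h
  -- representatives of the classes: `(w a, w b)`, with `w b` raised by `n` if it is below `w a`
  let e : Fin n × Fin n → ℤ := fun p => if w p.1 < w p.2 then 0 else 1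
  have he : ∀ a b, a < b → (w a < w b ∧ e (a, b) = 0) ∨ (w b < w a ∧ e (a, b) = 1) := by
    intro a b hab
    rcases lt_or_gt_of_ne fun e => hab.ne (w.injective e) with hw | hw
    · exact Or.inl ⟨hw, if_pos hw⟩
    · exact Or.inr ⟨hw, if_neg hw.asymm⟩
  have hinv : ∀ p ∈ lengthPairs k u w,
      (w p.1 : ℤ) + 1 + n * 0 < (w p.2 : ℤ) + 1 + n * e p ∧
      (pairAffine k u w).1 ((w p.2 : ℤ) + 1 + n * e p) <
        (pairAffine k u w).1 ((w p.1 : ℤ) + 1 + n * 0) := by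
    rintro ⟨a, b⟩ hp
    simp only [mem_lengthPairs, Fin.lt_def, SameBlock] at hp
    obtain ⟨hab, hp⟩ := hp
    rw [pairAffine_apply, pairAffine_apply]
    have hua := (u a).2
    have hub := (u b).2
    have hwa := (w a).2
    have hwb := (w b).2
    simp only
    have he' := he a b hab
    simp only [Fin.lt_def] at he'
    rcases omega_eq_zero_or_one k a with ⟨h5, h6⟩ | ⟨h5, h6⟩ <;>
    rcases omega_eq_zero_or_one k b with ⟨h7, h8⟩ | ⟨h7, h8⟩ <;>
    rcases he' with ⟨hw, h9⟩ | ⟨hw, h9⟩ <;>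
    rw [h6, h8, h9] <;> split_ifs at hp <;> constructor <;> omega
  let F : {p // p ∈ lengthPairs k u w} →
      Quotient (affineInversionSetoid (pairAffine k u w)) := fun p =>
    Quotient.mk _ ⟨((w p.1.1 : ℤ) + 1 + n * 0, (w p.1.2 : ℤ) + 1 + n * e p.1), hinv p.1 p.2⟩
  have hF : Function.Bijective F := by
    constructor
    · rintro ⟨⟨a, b⟩, hp⟩ ⟨⟨a', b'⟩, hp'⟩ hpq
      obtain ⟨r, h3, h4⟩ := Quotient.exact hpq
      simp only at h3 h4
      have h5 := (coord_inj (s := r) (h3.trans (by ring))).1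
      have h6 := (coord_inj (s := e (a, b) + r) (h4.trans (by ring))).1
      have h7 := w.injective h5
      have h8 := w.injective h6
      subst h7; subst h8; rfl
    · intro q
      obtain ⟨⟨⟨i, j⟩, hij, hf⟩, rfl⟩ := Quotient.exists_rep q
      simp only at hij hf
      obtain ⟨a, r, rfl⟩ := exists_coord_perm w i
      obtain ⟨b, s, rfl⟩ := exists_coord_perm w j
      have hbd := isBounded_pairAffine_iff.2 h1
      have hbi := (hbd ((w a : ℤ) + 1 + n * r)).2
      have hbj := (hbd ((w b : ℤ) + 1 + n * s)).1
      obtain ⟨m, hs⟩ : ∃ m, s = r + m := ⟨s - r, by ring⟩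
      subst hs
      rw [pairAffine_apply] at hbi hbj
      rw [pairAffine_apply, pairAffine_apply] at hf
      have hua := (u a).2
      have hub := (u b).2
      have hwa := (w a).2
      have hwb := (w b).2
      have hm0 : -1 < m := by
        by_contra hlt
        have : (n : ℤ) * m ≤ n * (-1) := mul_le_mul_of_nonneg_left (not_lt.1 hlt) (by positivity)
        rw [mul_add] at hij
        omega
      have hm1 : m < 2 := by
        by_contra hlt
        have : (n : ℤ) * 2 ≤ n * m := mul_le_mul_of_nonneg_left (not_lt.1 hlt) (by positivity)
        simp only [mul_add] at *
        omega
      have hne : a ≠ b := by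
        rintro rfl
        obtain rfl | rfl : m = 0 ∨ m = 1 := by omega
        · simp at hij
        · simp only [mul_add] at hf; omega
      have hne' : (a : ℕ) ≠ b := fun e => hne (Fin.ext e)
      have hlt : a < b ∧ (a < b → m = e (a, b) ∧ (a, b) ∈ lengthPairs k u w) := by
        rw [mem_lengthPairs]
        have hba := h2 b a
        have hwe := he a b
        have hwne : (w a : ℕ) ≠ w b := fun e => hne (w.injective (Fin.ext e))
        have hune : (u a : ℕ) ≠ u b := fun e => hne (u.injective (Fin.ext e))
        simp only [Fin.lt_def, SameBlock] at hba hwe ⊢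
        obtain rfl | rfl : m = 0 ∨ m = 1 := by omega
        all_goals
          simp only [mul_add] at hf hij hbi hbj
          rcases omega_eq_zero_or_one k a with ⟨h5, h6⟩ | ⟨h5, h6⟩ <;>
          rcases omega_eq_zero_or_one k b with ⟨h7, h8⟩ | ⟨h7, h8⟩ <;>
          simp only [h6, h8] at hf hbi hbj <;>
          refine ⟨by omega, fun hab => ?_⟩ <;>
          rcases hwe hab with ⟨hw, h9⟩ | ⟨hw, h9⟩ <;>
          rw [h9] <;> refine ⟨by omega, hab, ?_⟩ <;> split_ifs <;> omega
      obtain ⟨hm, hmem⟩ := hlt.2 hlt.1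
      subst hm
      refine ⟨⟨(a, b), hmem⟩, Quotient.sound ⟨r, ?_, ?_⟩⟩
      · simp only; ring
      · simp only; ring
  unfold affineLength
  rw [← Nat.card_congr (Equiv.ofBijective F hF)]
  simp

end Length

end Positroid

theorem theoremT (k n : ℕ) [NeZero n] (hkn : k ≤ n) :
    IsPartialOrder (Positroid.Q k n) (fun q q' => q ≤ q') ∧
    (∃ φ : Positroid.Q k n ≃o Positroid.Bound k n,
      ∀ I : Positroid.KBruhatInterval k n,
        (φ (Positroid.Q.mk I)).f = Positroid.pairAffine k I.u I.w) ∧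
    (∀ I : Positroid.KBruhatInterval k n,
      (Positroid.affineLength (Positroid.pairAffine k I.u I.w) : ℤ) =
        (k : ℤ) * ((n : ℤ) - (k : ℤ)) - (Positroid.permLength I.w : ℤ) +
          (Positroid.permLength I.u : ℤ)) := by
  let F : Positroid.Q k n → Positroid.Bound k n := Quotient.lift
    (fun I => ⟨Positroid.pairAffine k I.u I.w, Positroid.ballNumber_pairAffine hkn I.u I.w,
      Positroid.isBounded_pairAffine_iff.2 (Positroid.kBruhatLE_iff.1 I.le).1⟩)
    fun I J h => Positroid.Bound.ext_f (Positroid.pairAffine_eq_of_mk_eq (Quotient.sound h))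
  have hF : ∀ I, (F (Positroid.Q.mk I)).f = Positroid.pairAffine k I.u I.w := fun _ => rfl
  have hex : ∀ q : Positroid.Q k n, ∃ I, Positroid.Q.mk I = q := Quotient.exists_rep
  have hinj : Function.Injective F := by
    intro p q h
    obtain ⟨I, rfl⟩ := hex p
    obtain ⟨J, rfl⟩ := hex q
    exact Positroid.mk_eq_of_pairAffine_eq (congrArg Positroid.Bound.f h)
  have hsurj : Function.Surjective F := fun f => by
    obtain ⟨I, hI⟩ := f.exists_pairAffine_eq hkn
    exact ⟨Positroid.Q.mk I, Positroid.Bound.ext_f hI⟩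
  have hle : ∀ p q, F p ≤ F q ↔ p ≤ q := by
    intro p q
    constructor
    · intro h
      obtain ⟨I', rfl⟩ := hex p
      have h' := Positroid.affineBruhatLEOn_iff.1 h
      rw [hF] at h'
      obtain ⟨I, h1, h2, h3⟩ := Positroid.AffineBruhatLE.exists_kBruhatInterval h' (F q).bounded
      exact ⟨I', I, rfl, hinj (Positroid.Bound.ext_f h3),
        (Positroid.bruhatInterval_subset_iff I.le.bruhatLE).2 ⟨h1, h2⟩⟩
    · rintro ⟨I', I, rfl, rfl, h⟩
      exact Positroid.affineBruhatLEOn_iff.2 (Positroid.affineBruhatLE_of_subset h)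
  refine ⟨?_, ⟨⟨Equiv.ofBijective F ⟨hinj, hsurj⟩, fun {p q} => hle p q⟩, hF⟩, fun I => ?_⟩
  · exact
      { refl := fun p => (hle p p).1 le_rfl
        trans := fun p q r h1 h2 => (hle p r).1 (((hle p q).2 h1).trans ((hle q r).2 h2))
        antisymm := fun p q h1 h2 => hinj (((hle p q).2 h1).antisymm ((hle q p).2 h2)) }
  · have h := I.le.card_lengthPairs hkn
    rw [← I.le.affineLength_eq_card] at h
    have h' : ((n - k : ℕ) : ℤ) = (n : ℤ) - k := by push_cast [hkn]; rfl
    rw [← h']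
    have h'' : ((_ + _ : ℕ) : ℤ) = ((_ + _ : ℕ) : ℤ) := congrArg Nat.cast h
    push_cast at h''
    linarith
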